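/- Let $n\ge 1$ be an integer, $\lambda\in[0,\frac{2\pi}{n})$, $\mathbb{D}=\{|z|<1\}$, $\mathbb{T}=\{|z|=1\}$, and let $\pi_n(\Omega)$ be the set of complex polynomials of degree exactly $n$ with all zeros in $\Omega$. For a polynomial $F$ of degree $\le n$ put $F^{*n}(z)=z^n\overline{F(1/\overline z)}$, $F_\pm(z)=F(e^{\pm i\lambda/2}z)$, and $$\Delta_\lambda^n[F](z)=\frac{F_+(z)-F_-(z)}{2iz\sin(n\lambda/2)}\quad(\lambda>0),\qquad \Delta_0^n[F]=F'/n .$$ Let $\overline{\mathcal T}_n(\lambda)$ (resp. $\mathcal T_n(\lambda)$) be the set of $F\in\pi_n(\mathbb T)$ for which every pair of zeros, counted with multiplicity, is separated by an angle $\ge\lambda$ (resp. $>\lambda$). For $\lambda>0$ let $\overline{\mathcal D}_n(\lambda)$ be the set of polynomials $F$ of degree $n$ with $\operatorname{Im}\bigl(e^{-in\lambda/2}F_+(z)/F_-(z)\bigr)>0$ for all $|z|>1$, and let $\mathcal D_n(\lambda)$ be the union of $\mathcal T_n(\lambda)$ with the set of polynomials $F$ of degree $n$ for which this inequality holds for all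 $|z|\ge1$; put $\overline{\mathcal D}_n(0)=\pi_n(\overline{\mathbb D})$ and $\mathcal D_n(0)=\pi_n(\mathbb D)\cup\mathcal T_n(0)$. For $P\in\pi_n(\mathbb T)$ let $c_P$ be the unique number in $\{e^{it}:0\le t<\pi\}$ with $(c_PP)^{*n}=c_PP$. **Theorem.** Let $P,Q\in\pi_n(\mathbb T)$ with $c_P\ne c_Q$, let $F=P-Q$, and let $$R=\frac{c_P\,\Delta_\lambda^n[P]}{c_Q\,\Delta_\lambda^n[Q]},$$ evaluated pointwise (so "$R$ maps $S$ into a half-plane" includes that $\Delta_\lambda^n[Q]$ has no zero in $S$). If $F\in\pi_n(\overline{\mathbb D})$, then: 1. $F\in\overline{\mathcal D}_n(\lambda)\setminus\overline{\mathcal T}_n(\lambda)$ if and only if $R$ maps $\{|z|>1\}$ into the open upper half-plane or maps it into the open lower half-plane. 2. $F\in\mathcal D_n(\lambda)\setminus\mathcal T_n(\lambda)$ if and only if $R$ maps $\{|z|\ge1\}$ into the open upper half-plane or maps it into the open lower half-plane. Without the assumption $F\in\pi_n(\overline{\mathbb D})$, the condition on $R$ in 1 holds if and only if $F$ or $F^{*n}$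 belongs to $\overline{\mathcal D}_n(\lambda)\setminus\overline{\mathcal T}_n(\lambda)$, and the condition on $R$ in 2 holds if and only if $F$ or $F^{*n}$ belongs to $\mathcal D_n(\lambda)\setminus\mathcal T_n(\lambda)$. -/

import Mathlib

open Polynomial

noncomputable section

/-- `π_n(Ω)`: the complex polynomials of exact degree `n` all of whose zeros lie in `Ω`. -/
def zerosIn (n : ℕ) (Ω : Set ℂ) : Set ℂ[X] :=
  {F | F.degree = n ∧ ∀ z : ℂ, F.IsRoot z → z ∈ Ω}

/-- The open unit disk. -/
def openDisk : Set ℂ := {z | ‖z‖ < 1}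

/-- The closed unit disk. -/
def closedDisk : Set ℂ := {z | ‖z‖ ≤ 1}

/-- The unit circle. -/
def unitCircle : Set ℂ := {z | ‖z‖ = 1}

/-- The `n`-inverse `F^{*n}(z) = z^n * conj (F (1 / conj z))` of a polynomial of degree `≤ n`;
its `k`-th coefficient is the conjugate of the `(n-k)`-th coefficient of `F`. -/
def nInverse (n : ℕ) (F : ℂ[X]) : ℂ[X] :=
  Polynomial.reflect n (F.map (starRingEnd ℂ))

theorem nInverse_eval (n : ℕ) (F : ℂ[X]) (hF : F.natDegree ≤ n) (z : ℂ) (hz : z ≠ 0) :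
    (nInverse n F).eval z = z ^ n * starRingEnd ℂ (F.eval (1 / starRingEnd ℂ z)) := by
  let _ : Invertible z⁻¹ := invertibleOfNonzero (inv_ne_zero hz)
  have h := Polynomial.eval₂_reflect_mul_pow (RingHom.id ℂ) z⁻¹ n (F.map (starRingEnd ℂ))
    (le_trans (Polynomial.natDegree_map_le) hF)
  rw [invOf_eq_inv, inv_inv] at h
  have h1 : (F.map (starRingEnd ℂ)).eval z⁻¹ =
      starRingEnd ℂ (F.eval (1 / starRingEnd ℂ z)) := by
    rw [← Polynomial.eval_map_apply]
    simp
  rw [← h1]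
  change (nInverse n F).eval z * z⁻¹ ^ n = (F.map (starRingEnd ℂ)).eval z⁻¹ at h
  rw [← h, mul_left_comm, ← mul_pow, mul_inv_cancel₀ hz, one_pow, mul_one]

/-- `c = c_P`: the number in `{e^{it} : 0 ≤ t < π}` for which `c P` is `n`-self-inversive. -/
def IsPhase (n : ℕ) (P : ℂ[X]) (c : ℂ) : Prop :=
  (∃ t : ℝ, 0 ≤ t ∧ t < Real.pi ∧ c = Complex.exp (t * Complex.I)) ∧
    nInverse n (C c * P) = C c * P

theorem nInverse_C_mul (n : ℕ) (a : ℂ) (F : ℂ[X]) :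
    nInverse n (C a * F) = C (starRingEnd ℂ a) * nInverse n F := by
  simp [nInverse, Polynomial.reflect_C_mul]

theorem nInverse_prod (s : Multiset ℂ) (hs : ∀ r ∈ s, ‖r‖ = 1) :
    ∃ u : ℂ, ‖u‖ = 1 ∧ nInverse (Multiset.card s) (s.map fun r => X - C r).prod =
      C u * (s.map fun r => X - C r).prod := by
  induction s using Multiset.induction with
  | empty => exact ⟨1, by simp, by simp [nInverse]⟩
  | cons a s ih =>
    obtain ⟨u, hu, h⟩ := ih fun r hr => hs r (Multiset.mem_cons_of_mem hr)
    have ha : ‖a‖ = 1 := hs a (Multiset.mem_cons_self a s)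
    refine ⟨-starRingEnd ℂ a * u, by simp [ha, hu], ?_⟩
    have hlin : nInverse 1 (X - C a) = C (-starRingEnd ℂ a) * (X - C a) := by
      have : starRingEnd ℂ a * a = 1 := by
        rw [mul_comm, Complex.mul_conj, Complex.normSq_eq_norm_sq, ha]; simp
      have h1 : (C (starRingEnd ℂ a) * C a : ℂ[X]) = 1 := by rw [← C_mul, this, C_1]
      simp only [nInverse, Polynomial.map_sub, Polynomial.map_X, Polynomial.map_C,
        Polynomial.reflect_sub, Polynomial.reflect_one_X, Polynomial.reflect_C, pow_one, C_neg]
      linear_combination (-1 : ℂ[X]) * h1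
    have hmul : nInverse (Multiset.card s + 1) ((s.map fun r => X - C r).prod * (X - C a)) =
        nInverse (Multiset.card s) (s.map fun r => X - C r).prod * nInverse 1 (X - C a) := by
      unfold nInverse
      rw [Polynomial.map_mul]
      apply Polynomial.reflect_mul
      · refine le_trans Polynomial.natDegree_map_le ?_
        rw [Polynomial.natDegree_multiset_prod_X_sub_C_eq_card]
      · refine le_trans Polynomial.natDegree_map_le ?_
        simp
    rw [Multiset.map_cons, Multiset.prod_cons, Multiset.card_cons, mul_comm (X - C a), hmul, h,
      hlin, C_mul]
    ring

/-- For polynomials with all zeros on the unit circle, `c_P` exists and is unique. -/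
theorem existsUnique_isPhase (n : ℕ) (P : ℂ[X]) (hP : P ∈ zerosIn n unitCircle) :
    ∃! c : ℂ, IsPhase n P c := by
  obtain ⟨hdeg, hroots⟩ := hP
  have hP0 : P ≠ 0 := by rintro rfl; simp at hdeg
  have hsplit := IsAlgClosed.splits P
  have hfac := hsplit.eq_prod_roots
  have hcard : Multiset.card P.roots = n := by
    rw [← hsplit.natDegree_eq_card_roots]; exact natDegree_eq_of_degree_eq_some hdeg
  obtain ⟨u, hu, h⟩ := nInverse_prod P.roots fun r hr =>
    hroots r ((Polynomial.mem_roots hP0).1 hr)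
  rw [hcard] at h
  set a := P.leadingCoeff with ha
  have ha0 : a ≠ 0 := by simpa [ha] using hP0
  obtain ⟨v, hv, hPv⟩ : ∃ v : ℂ, ‖v‖ = 1 ∧ nInverse n P = C v * P := by
    refine ⟨starRingEnd ℂ a * u / a, by simp [hu, ha0], ?_⟩
    conv_lhs => rw [hfac]
    conv_rhs => rw [hfac]
    rw [nInverse_C_mul, h, ← mul_assoc, ← mul_assoc, ← C_mul, ← C_mul]
    congr 2
    field_simp
  have key : ∀ c : ℂ, ‖c‖ = 1 → (nInverse n (C c * P) = C c * P ↔ c ^ 2 = v) := by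
    intro c hc
    have hcc : c * starRingEnd ℂ c = 1 := by
      rw [Complex.mul_conj, Complex.normSq_eq_norm_sq, hc]; simp
    rw [nInverse_C_mul, hPv, ← mul_assoc, ← C_mul, mul_left_inj' hP0, C_inj]
    constructor
    · intro h; linear_combination (-c) * h + v * hcc
    · intro h; linear_combination (-starRingEnd ℂ c) * h + c * hcc
  have hnorm : ∀ t : ℝ, ‖Complex.exp (t * Complex.I)‖ = 1 := Complex.norm_exp_ofReal_mul_I
  have hpi := Real.pi_pos
  obtain ⟨t, ht0, htpi, ht⟩ : ∃ t : ℝ, 0 ≤ t ∧ t < Real.pi ∧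
      Complex.exp (t * Complex.I) ^ 2 = v := by
    have hvexp : Complex.exp (Complex.arg v * Complex.I) = v := by
      have := Complex.norm_mul_exp_arg_mul_I v
      simpa [hv] using this
    by_cases hneg : 0 ≤ Complex.arg v
    · refine ⟨Complex.arg v / 2, by linarith, by linarith [Complex.arg_le_pi v], ?_⟩
      rw [← Complex.exp_nat_mul, ← hvexp]
      congr 1
      simp [hvexp]
      ring
    · push Not at hneg
      refine ⟨Complex.arg v / 2 + Real.pi, by linarith [Complex.neg_pi_lt_arg v],
        by linarith, ?_⟩
      rw [← Complex.exp_nat_mul]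
      have : ((2 : ℕ) : ℂ) * (((Complex.arg v / 2 + Real.pi : ℝ) : ℂ) * Complex.I) =
          Complex.arg v * Complex.I + 2 * Real.pi * Complex.I := by
        push_cast; ring
      rw [this, Complex.exp_add, Complex.exp_two_pi_mul_I, mul_one, hvexp]
  refine ⟨Complex.exp (t * Complex.I), ⟨⟨t, ht0, htpi, rfl⟩, (key _ (hnorm t)).2 ht⟩, ?_⟩
  rintro c ⟨⟨s, hs0, hspi, rfl⟩, hc⟩
  have hs := (key _ (hnorm s)).1 hc
  rw [← ht, sq_eq_sq_iff_eq_or_eq_neg] at hs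
  rcases hs with hs | hs
  · exact hs
  · exfalso
    have hne : Complex.exp ((s - t : ℝ) * Complex.I) = -1 := by
      push_cast
      rw [sub_mul, Complex.exp_sub, hs]
      field_simp
    have hre := congrArg Complex.re hne
    rw [Complex.exp_ofReal_mul_I_re] at hre
    have hlt : |s - t| < Real.pi := by rw [abs_lt]; constructor <;> linarith
    have := Real.cos_lt_cos_of_nonneg_of_le_pi (abs_nonneg (s - t)) le_rfl hlt
    rw [Real.cos_abs, Real.cos_pi] at this
    simp at hre
    linarith

/-- The class closed-`T_n(λ)`: degree `n`, all zeros on the unit circle, and any two zeros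
(counted with multiplicity, so a multiple zero is a pair at angle `0`) are separated by an angle
of at least `λ`. -/
def TBar (n : ℕ) (lam : ℝ) : Set ℂ[X] :=
  {F | F ∈ zerosIn n unitCircle ∧
    ∀ z ∈ F.roots, ∀ w ∈ F.roots.erase z, lam ≤ |Complex.arg (z / w)|}

/-- The class `T_n(λ)`: as above, with every pair of zeros separated by an angle `> λ`. -/
def TOpen (n : ℕ) (lam : ℝ) : Set ℂ[X] :=
  {F | F ∈ zerosIn n unitCircle ∧
    ∀ z ∈ F.roots, ∀ w ∈ F.roots.erase z, lam < |Complex.arg (z / w)|}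

/-- The quotient `e^{-inλ/2} F(e^{iλ/2} z) / F(e^{-iλ/2} z)`. -/
def rotQuot (n : ℕ) (lam : ℝ) (F : ℂ[X]) (z : ℂ) : ℂ :=
  Complex.exp (-(Complex.I * n * lam / 2)) *
    (F.eval (Complex.exp (Complex.I * lam / 2) * z) /
      F.eval (Complex.exp (-(Complex.I * lam / 2)) * z))

open Classical in
/-- The class closed-`D_n(λ)` for `0 ≤ λ < 2π/n`. (Where the denominator of `rotQuot` vanishes,
its value is `0` and the strict inequality fails.) -/
def DBar (n : ℕ) (lam : ℝ) : Set ℂ[X] :=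
  if lam = 0 then zerosIn n closedDisk
  else {F | F.degree = n ∧ ∀ z : ℂ, 1 < ‖z‖ → 0 < (rotQuot n lam F z).im}

open Classical in
/-- The class `D_n(λ)` for `0 ≤ λ < 2π/n`. -/
def DOpen (n : ℕ) (lam : ℝ) : Set ℂ[X] :=
  if lam = 0 then zerosIn n openDisk ∪ TOpen n 0
  else TOpen n lam ∪ {F | F.degree = n ∧ ∀ z : ℂ, 1 ≤ ‖z‖ → 0 < (rotQuot n lam F z).im}

open Classical in
/-- The operator `Δ_λ^n`: the polynomial `(F(e^{iλ/2} z) - F(e^{-iλ/2} z)) / (2 i z sin(nλ/2))`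
for `0 < λ < 2π/n`, and `F' / n` for `λ = 0`. (`divX` is an exact division by the variable here,
as the constant terms cancel.) -/
def qDelta (n : ℕ) (lam : ℝ) (F : ℂ[X]) : ℂ[X] :=
  if lam = 0 then C (1 / (n : ℂ)) * derivative F
  else C (1 / (2 * Complex.I * Real.sin (n * lam / 2))) *
    (F.comp (C (Complex.exp (Complex.I * lam / 2)) * X) -
      F.comp (C (Complex.exp (-(Complex.I * lam / 2))) * X)).divX

theorem qDelta_eval (n : ℕ) (lam : ℝ) (hlam : lam ≠ 0) (F : ℂ[X]) (z : ℂ) (hz : z ≠ 0) :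
    (qDelta n lam F).eval z =
      (F.eval (Complex.exp (Complex.I * lam / 2) * z) -
        F.eval (Complex.exp (-(Complex.I * lam / 2)) * z)) /
      (2 * Complex.I * z * Real.sin (n * lam / 2)) := by
  set G := F.comp (C (Complex.exp (Complex.I * lam / 2)) * X) -
      F.comp (C (Complex.exp (-(Complex.I * lam / 2))) * X) with hG
  have h0 : G.coeff 0 = 0 := by
    rw [Polynomial.coeff_zero_eq_eval_zero]; simp [hG]
  have h1 := congrArg (Polynomial.eval z) (Polynomial.divX_mul_X_add G)
  rw [h0] at h1
  have h2 : G.eval z = F.eval (Complex.exp (Complex.I * lam / 2) * z) -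
        F.eval (Complex.exp (-(Complex.I * lam / 2)) * z) := by
    simp [hG]
  rw [← h2, ← h1, qDelta, if_neg hlam, ← hG]
  simp only [eval_mul, eval_C, eval_X, add_zero, map_zero]
  field_simp

/-- `R` maps `S` into the open upper half-plane, or maps `S` into the open lower half-plane. -/
def MapsIntoHalfPlane (R : ℂ → ℂ) (S : Set ℂ) : Prop :=
  Set.MapsTo R S {w | 0 < w.im} ∨ Set.MapsTo R S {w | w.im < 0}

/-- The function `R = c_P Δ_λ^n[P] / (c_Q Δ_λ^n[Q])`, evaluated pointwise. (Its value is `0`, on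
the real axis, where `Δ_λ^n[Q]` vanishes; so `R` can map a set into an open half-plane only if
`Δ_λ^n[Q]` has no zero there.) -/
def deltaQuot (n : ℕ) (lam : ℝ) (cP : ℂ) (P : ℂ[X]) (cQ : ℂ) (Q : ℂ[X]) (z : ℂ) : ℂ :=
  (cP * (qDelta n lam P).eval z) / (cQ * (qDelta n lam Q).eval z)

end

/-!
Write `a = Δ_λ^n[F]` and `b = Δ_λ^n[F^{*n}]` for `F = P - Q`, polynomials of degree at most `n - 1`.

*The quotient.* With `x = c_P Δ_λ^n[P]` and `y = c_Q Δ_λ^n[Q]`, the self-inversiveness of `c_P P`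
and `c_Q Q` gives `a = conj c_P x - conj c_Q y` and `b = c_P x - c_Q y`, so that
`|a|² - |b|² = 4 κ Im (x conj y)` with the real constant `κ = Im (conj c_P c_Q) ≠ 0`
(`norm_qDelta_sub_sq`). Hence `R = x / y` maps a set into an open half-plane if and only if
`|b| < |a|` throughout the set or `|a| < |b|` throughout it
(`mapsIntoHalfPlane_deltaQuot_iff`); replacing `F` by `F^{*n}` exchanges the two alternatives.

*The classes.* Let `h` be the `(n-1)`-inverse of `b` (`dualDelta`). For `λ > 0` it is a constant
multiple of `e^{inλ/2} F_- - e^{-inλ/2} F_+`, and the half-plane condition on `rotQuot` is, point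
by point, the inequality `|h(z)| < |z a(z)|`. For `λ = 0` this inequality reads
`|n F - z F'| < |z F'|`, which outside a disk containing the zeros of `F` follows from
`Re (z / (z - ζ)) > 1/2` for each zero `ζ`, and which fails at a zero of `F`. So
`F ∈ DBar` means `deg F = n` and `|h| < |z a|` on `|z| > 1`, and similarly for `DOpen`.

*Comparison.* It remains to relate `|h| < |z a|` to `|b| < |a|` outside the disk. As `b` and its
`(n-1)`-inverse `h` have equal modulus on the circle, both are instances of one maximum principle
(`eq_C_mul_or_norm_lt_of_norm_le_on_circle`), after reflection in the circle. The two conditions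
are equivalent, unless `b = c a` with `|c| = 1`. In that case `F^{*n} = c F`, and if also
`F ∈ DBar`, all zeros of `F` lie on the circle; then `F ∈ TBar`, and it is this case which the
removal of `TBar` excludes.

*Separation of the zeros.* For `λ > 0`, and `F` with all zeros on the circle, the argument of
`rotQuot` on `|z| > 1` is a sum of one continuous angle for each zero (`factorAngle`), equal to
`nλ/2 ∈ (0, π)` at infinity. If `rotQuot` stays in the upper half-plane, the sum stays in `(0, π)`.
Its boundary value at a point of the circle is `π` times the number of zeros within angle `λ/2`, so
that two zeros at an angle less than `λ` would give the value `2π` somewhere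
(`mem_TBar_of_im_rotQuot_pos`).
-/

open Polynomial

/-! ### The `n`-inverse -/

theorem coeff_nInverse (n : ℕ) (F : ℂ[X]) (k : ℕ) :
    (nInverse n F).coeff k = starRingEnd ℂ (F.coeff (revAt n k)) := by
  simp [nInverse, coeff_reflect]

theorem natDegree_nInverse_le {n : ℕ} {F : ℂ[X]} (hF : F.natDegree ≤ n) :
    (nInverse n F).natDegree ≤ n := by
  refine natDegree_reflect_le.trans (max_le le_rfl ?_)
  exact natDegree_map_le.trans hF

theorem nInverse_nInverse (n : ℕ) (F : ℂ[X]) : nInverse n (nInverse n F) = F := by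
  ext k
  simp [coeff_nInverse, revAt_invol]

theorem norm_eval_nInverse {n : ℕ} {F : ℂ[X]} (hF : F.natDegree ≤ n) {z : ℂ} (hz : z ≠ 0) :
    ‖(nInverse n F).eval z‖ = ‖z‖ ^ n * ‖F.eval (1 / starRingEnd ℂ z)‖ := by
  rw [nInverse_eval n F hF z hz, norm_mul, norm_pow, RCLike.norm_conj]

theorem one_div_conj_of_norm_eq_one {z : ℂ} (hz : ‖z‖ = 1) : 1 / starRingEnd ℂ z = z := by
  have h : z * starRingEnd ℂ z = 1 := by
    rw [Complex.mul_conj, Complex.normSq_eq_norm_sq, hz]; simp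
  exact (eq_one_div_of_mul_eq_one_left h).symm

theorem norm_eval_nInverse_of_norm_eq_one {n : ℕ} {F : ℂ[X]} (hF : F.natDegree ≤ n) {z : ℂ}
    (hz : ‖z‖ = 1) : ‖(nInverse n F).eval z‖ = ‖F.eval z‖ := by
  have hz0 : z ≠ 0 := by rintro rfl; simp at hz
  rw [norm_eval_nInverse hF hz0, one_div_conj_of_norm_eq_one hz, hz, one_pow, one_mul]

theorem norm_one_div_conj (z : ℂ) : ‖1 / starRingEnd ℂ z‖ = ‖z‖⁻¹ := by
  simp

/-! ### Comparison of two polynomials on the unit disk -/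

/-- The points of the circle other than `ζ` accumulate at `ζ`. -/
theorem norm_eval_le_of_forall_ne {B G : ℂ[X]} {ζ : ℂ} (hζ : ‖ζ‖ = 1)
    (h : ∀ z : ℂ, ‖z‖ = 1 → z ≠ ζ → ‖G.eval z‖ ≤ ‖B.eval z‖) :
    ‖G.eval ζ‖ ≤ ‖B.eval ζ‖ := by
  have hcont : Continuous fun t : ℝ => ζ * Complex.exp (t * Complex.I) := by fun_prop
  have hlim : ∀ p : ℂ[X], Filter.Tendsto
      (fun t : ℝ => ‖p.eval (ζ * Complex.exp (t * Complex.I))‖) (nhdsWithin 0 (Set.Ioi 0))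
      (nhds ‖p.eval ζ‖) := by
    intro p
    have h1 : Continuous fun t : ℝ => ‖p.eval (ζ * Complex.exp (t * Complex.I))‖ :=
      (p.continuous.comp hcont).norm
    have h2 := (h1.tendsto 0).mono_left (nhdsWithin_le_nhds (s := Set.Ioi 0))
    simpa using h2
  refine le_of_tendsto_of_tendsto (hlim G) (hlim B) ?_
  filter_upwards [Ioo_mem_nhdsGT Real.pi_pos] with t ht
  refine h _ (by simp [hζ, Complex.norm_exp_ofReal_mul_I]) fun heq => ?_
  have hζ0 : ζ ≠ 0 := by rintro rfl; simp at hζ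
  have h1 : Complex.exp (t * Complex.I) = 1 := mul_left_cancel₀ hζ0 (by rw [heq, mul_one])
  have h2 := congrArg Complex.im h1
  rw [Complex.exp_ofReal_mul_I_im] at h2
  exact (Real.sin_pos_of_pos_of_lt_pi ht.1 ht.2).ne' (by simpa using h2)

theorem eq_C_mul_or_norm_lt_of_zero_free_closedBall {B G : ℂ[X]}
    (hB : ∀ z : ℂ, ‖z‖ ≤ 1 → B.eval z ≠ 0)
    (h : ∀ z : ℂ, ‖z‖ = 1 → ‖G.eval z‖ ≤ ‖B.eval z‖) :
    (∃ c : ℂ, ‖c‖ = 1 ∧ G = C c * B) ∨ ∀ z : ℂ, ‖z‖ < 1 → ‖G.eval z‖ < ‖B.eval z‖ := by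
  set f : ℂ → ℂ := fun z => G.eval z / B.eval z with hf
  have hdiff : DifferentiableOn ℂ f (Metric.closedBall 0 1) := by
    intro z hz
    have hz' : ‖z‖ ≤ 1 := by simpa using hz
    exact (G.differentiable.differentiableAt.div B.differentiable.differentiableAt
      (hB z hz')).differentiableWithinAt
  have hle : ∀ z : ℂ, ‖z‖ ≤ 1 → ‖f z‖ ≤ 1 := by
    intro z hz
    refine Complex.norm_le_of_forall_mem_frontier_norm_le (U := Metric.ball (0 : ℂ) 1)
      Metric.isBounded_ball ?_ ?_ ?_
    · exact (hdiff.mono (closure_ball (0 : ℂ) one_ne_zero).subset).diffContOnCl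
    · intro w hw
      rw [frontier_ball (0 : ℂ) one_ne_zero] at hw
      have hw' : ‖w‖ = 1 := by simpa using hw
      rw [hf, norm_div]
      exact div_le_one_of_le₀ (h w hw') (norm_nonneg _)
    · rw [closure_ball (0 : ℂ) one_ne_zero]; simpa using hz
  by_cases hlt : ∀ z : ℂ, ‖z‖ < 1 → ‖f z‖ < 1
  · right
    intro z hz
    have := hlt z hz
    rwa [hf, norm_div, div_lt_one (norm_pos_iff.2 (hB z hz.le))] at this
  · left
    push Not at hlt
    obtain ⟨w, hw, hw1⟩ := hlt
    have hw1 : ‖f w‖ = 1 := le_antisymm (hle w hw.le) hw1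
    have hmax : IsMaxOn (norm ∘ f) (Metric.ball 0 1) w := by
      intro z hz
      have hz' : ‖z‖ < 1 := by simpa using hz
      simpa [hw1] using hle z hz'.le
    have heq := Complex.eqOn_of_isPreconnected_of_isMaxOn_norm
      (convex_ball (0 : ℂ) 1).isPreconnected Metric.isOpen_ball
      (hdiff.mono Metric.ball_subset_closedBall) (by simpa using hw) hmax
    refine ⟨f w, hw1, eq_of_infinite_eval_eq _ _ ?_⟩
    refine Set.Infinite.mono ?_ (infinite_of_mem_nhds (0 : ℂ) (Metric.ball_mem_nhds 0 one_pos))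
    intro z hz
    have hz' : ‖z‖ < 1 := by simpa using hz
    have h1 : G.eval z / B.eval z = f w := heq hz
    simp only [Set.mem_ofPred_eq, eval_mul, eval_C]
    rw [← h1, div_mul_cancel₀ _ (hB z hz'.le)]

/-- A maximum principle: zeros of `B` on the circle are harmless, since they are zeros of `G` as
well and cancel. -/
theorem eq_C_mul_or_norm_lt_of_norm_le_on_circle {B G : ℂ[X]}
    (hB : ∀ z : ℂ, ‖z‖ < 1 → B.eval z ≠ 0)
    (h : ∀ z : ℂ, ‖z‖ = 1 → ‖G.eval z‖ ≤ ‖B.eval z‖) :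
    (∃ c : ℂ, ‖c‖ = 1 ∧ G = C c * B) ∨ ∀ z : ℂ, ‖z‖ < 1 → ‖G.eval z‖ < ‖B.eval z‖ := by
  induction hd : B.natDegree generalizing B G with
  | zero =>
    refine eq_C_mul_or_norm_lt_of_zero_free_closedBall (fun z _ => ?_) h
    rw [eq_C_of_natDegree_eq_zero hd]
    have := hB 0 (by simp)
    rw [eq_C_of_natDegree_eq_zero hd] at this
    simpa using this
  | succ d ih =>
    by_cases hz : ∃ ζ : ℂ, ‖ζ‖ = 1 ∧ B.eval ζ = 0
    · obtain ⟨ζ, hζ, hBζ⟩ := hz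
      have hGζ : G.eval ζ = 0 := by
        have := h ζ hζ
        rw [hBζ, norm_zero] at this
        exact norm_le_zero_iff.1 this
      obtain ⟨B', rfl⟩ := dvd_iff_isRoot.2 hBζ
      obtain ⟨G', rfl⟩ := dvd_iff_isRoot.2 hGζ
      have hB'0 : B' ≠ 0 := by rintro rfl; simp at hd
      have hd' : B'.natDegree = d := by
        rw [natDegree_mul (X_sub_C_ne_zero ζ) hB'0, natDegree_X_sub_C] at hd
        omega
      have hne : ∀ z : ℂ, ‖z‖ = 1 → z ≠ ζ → ‖G'.eval z‖ ≤ ‖B'.eval z‖ := by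
        intro z hz hzζ
        have := h z hz
        simp only [eval_mul, norm_mul] at this
        refine le_of_mul_le_mul_left this (norm_pos_iff.2 ?_)
        simpa [sub_eq_zero] using hzζ
      have key := ih (B := B') (G := G') (fun z hz h0 => hB z hz (by simp [h0]))
        (fun z hz => ?_) hd'
      · rcases key with ⟨c, hc, hG'⟩ | hlt
        · left
          refine ⟨c, hc, ?_⟩
          rw [hG']; ring
        · right
          intro z hz
          simp only [eval_mul, norm_mul]
          refine mul_lt_mul_of_pos_left (hlt z hz) (norm_pos_iff.2 fun h0 => hB z hz ?_)
          rw [eval_mul, h0, zero_mul]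
      · by_cases hzζ : z = ζ
        · subst hzζ
          exact norm_eval_le_of_forall_ne hζ hne
        · exact hne z hz hzζ
    · push Not at hz
      refine eq_C_mul_or_norm_lt_of_zero_free_closedBall (fun z hz1 => ?_) h
      rcases hz1.lt_or_eq with h1 | h1
      · exact hB z h1
      · exact hz z h1

/-! ### Comparison of two polynomials outside the unit disk -/

theorem norm_eval_le_of_forall_one_lt {A B : ℂ[X]}
    (h : ∀ z : ℂ, 1 < ‖z‖ → ‖B.eval z‖ < ‖A.eval z‖) {z : ℂ} (hz : ‖z‖ = 1) :
    ‖B.eval z‖ ≤ ‖A.eval z‖ := by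
  have hlim : ∀ p : ℂ[X], Filter.Tendsto (fun t : ℝ => ‖p.eval (t * z)‖)
      (nhdsWithin 1 (Set.Ioi 1)) (nhds ‖p.eval z‖) := by
    intro p
    have h1 : Continuous fun t : ℝ => ‖p.eval (t * z)‖ :=
      (p.continuous.comp (by fun_prop : Continuous fun t : ℝ => (t : ℂ) * z)).norm
    have h2 := (h1.tendsto 1).mono_left (nhdsWithin_le_nhds (s := Set.Ioi 1))
    simpa using h2
  refine le_of_tendsto_of_tendsto (hlim B) (hlim A) ?_
  filter_upwards [self_mem_nhdsWithin] with t ht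
  have ht : (1 : ℝ) < t := ht
  refine (h _ ?_).le
  rw [norm_mul, hz, mul_one, Complex.norm_real, Real.norm_of_nonneg (by linarith)]
  exact ht

theorem one_lt_norm_one_div_conj {w : ℂ} (hw0 : w ≠ 0) (hw : ‖w‖ < 1) :
    1 < ‖1 / starRingEnd ℂ w‖ := by
  rw [norm_one_div_conj]
  exact (one_lt_inv₀ (norm_pos_iff.2 hw0)).2 hw

/-- Comparison of leading coefficients, which are the values at infinity. -/
theorem norm_coeff_le_of_forall_one_lt {m : ℕ} {a b : ℂ[X]} (ha : a.natDegree ≤ m)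
    (hb : b.natDegree ≤ m) (h : ∀ z : ℂ, 1 < ‖z‖ → ‖b.eval z‖ < ‖a.eval z‖) :
    ‖b.coeff m‖ ≤ ‖a.coeff m‖ := by
  have hlim : ∀ p : ℂ[X], Filter.Tendsto (fun w : ℂ => ‖(nInverse m p).eval w‖)
      (nhdsWithin 0 {0}ᶜ) (nhds ‖p.coeff m‖) := by
    intro p
    have h1 : Continuous fun w : ℂ => ‖(nInverse m p).eval w‖ := (nInverse m p).continuous.norm
    have h2 := (h1.tendsto 0).mono_left (nhdsWithin_le_nhds (s := {0}ᶜ))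
    rwa [← coeff_zero_eq_eval_zero, coeff_nInverse, revAt_le (Nat.zero_le m), Nat.sub_zero,
      RCLike.norm_conj] at h2
  refine le_of_tendsto_of_tendsto (hlim b) (hlim a) ?_
  filter_upwards [self_mem_nhdsWithin,
    nhdsWithin_le_nhds (Metric.ball_mem_nhds (0 : ℂ) one_pos)] with w hw0 hw
  have hw0 : w ≠ 0 := hw0
  have hw : ‖w‖ < 1 := by simpa using hw
  rw [norm_eval_nInverse ha hw0, norm_eval_nInverse hb hw0]
  exact mul_le_mul_of_nonneg_left (h _ (one_lt_norm_one_div_conj hw0 hw)).le (by positivity)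

theorem norm_one_div_conj_lt_one {z : ℂ} (hz : 1 < ‖z‖) : ‖1 / starRingEnd ℂ z‖ < 1 := by
  rw [norm_one_div_conj]
  exact inv_lt_one_of_one_lt₀ hz

theorem norm_eval_eq_norm_eval_nInverse {m : ℕ} {a : ℂ[X]} (ha : a.natDegree ≤ m) {z : ℂ}
    (hz : z ≠ 0) : ‖a.eval z‖ = ‖z‖ ^ m * ‖(nInverse m a).eval (1 / starRingEnd ℂ z)‖ := by
  rw [← norm_eval_nInverse (natDegree_nInverse_le ha) hz, nInverse_nInverse]

theorem eval_nInverse_ne_zero {m : ℕ} {a : ℂ[X]} (ha : a.natDegree ≤ m) (ham : a.coeff m ≠ 0)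
    (h : ∀ z : ℂ, 1 < ‖z‖ → a.eval z ≠ 0) {w : ℂ} (hw : ‖w‖ < 1) :
    (nInverse m a).eval w ≠ 0 := by
  by_cases hw0 : w = 0
  · rw [hw0, ← coeff_zero_eq_eval_zero, coeff_nInverse, revAt_le (Nat.zero_le m), Nat.sub_zero]
    simpa using ham
  · rw [← norm_ne_zero_iff, norm_eval_nInverse ha hw0]
    have := h _ (one_lt_norm_one_div_conj hw0 hw)
    positivity

/-- Reflecting `b` in the circle: the quotients `b / a` and `b^{*m} / (z a)` have the same modulus
on the circle, and the second one carries an additional factor vanishing at infinity. -/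
theorem norm_nInverse_lt_of_norm_lt {m : ℕ} {a b : ℂ[X]} (ha : a.natDegree ≤ m)
    (hb : b.natDegree ≤ m) (ham : a.coeff m ≠ 0)
    (h : ∀ z : ℂ, 1 < ‖z‖ → ‖b.eval z‖ < ‖a.eval z‖) {z : ℂ} (hz : 1 < ‖z‖) :
    ‖(nInverse m b).eval z‖ < ‖z * a.eval z‖ := by
  have hB : ∀ w : ℂ, ‖w‖ < 1 → (nInverse m a).eval w ≠ 0 := fun w hw =>
    eval_nInverse_ne_zero ha ham
      (fun z hz h0 => by simpa [h0] using (norm_nonneg _).trans_lt (h z hz)) hw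
  have hle : ∀ w : ℂ, ‖w‖ = 1 → ‖b.eval w‖ ≤ ‖(nInverse m a).eval w‖ := by
    intro w hw
    rw [norm_eval_nInverse_of_norm_eq_one ha hw]
    exact norm_eval_le_of_forall_one_lt h hw
  have hz0 : z ≠ 0 := by rintro rfl; simp at hz; linarith
  set w := 1 / starRingEnd ℂ z with hw
  have hw1 : ‖w‖ < 1 := norm_one_div_conj_lt_one hz
  have hle' : ‖b.eval w‖ ≤ ‖(nInverse m a).eval w‖ := by
    rcases eq_C_mul_or_norm_lt_of_norm_le_on_circle hB hle with ⟨c, hc, hG⟩ | hlt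
    · rw [hG, eval_mul, eval_C, norm_mul, hc, one_mul]
    · exact (hlt w hw1).le
  rw [norm_eval_nInverse hb hz0, norm_mul, norm_eval_eq_norm_eval_nInverse ha hz0, ← hw]
  have hpos : 0 < ‖z‖ ^ m * ‖(nInverse m a).eval w‖ := by
    have := norm_pos_iff.2 (hB w hw1)
    positivity
  calc ‖z‖ ^ m * ‖b.eval w‖ ≤ 1 * (‖z‖ ^ m * ‖(nInverse m a).eval w‖) := by
        rw [one_mul]; gcongr
    _ < ‖z‖ * (‖z‖ ^ m * ‖(nInverse m a).eval w‖) := mul_lt_mul_of_pos_right hz hpos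

theorem eq_C_mul_or_norm_lt_of_norm_nInverse_lt {m : ℕ} {a b : ℂ[X]} (ha : a.natDegree ≤ m)
    (hb : b.natDegree ≤ m) (ham : a.coeff m ≠ 0)
    (h : ∀ z : ℂ, 1 < ‖z‖ → ‖(nInverse m b).eval z‖ < ‖z * a.eval z‖) :
    (∃ c : ℂ, ‖c‖ = 1 ∧ b = C c * a) ∨ ∀ z : ℂ, 1 < ‖z‖ → ‖b.eval z‖ < ‖a.eval z‖ := by
  have hB : ∀ w : ℂ, ‖w‖ < 1 → (nInverse m a).eval w ≠ 0 := fun w hw =>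
    eval_nInverse_ne_zero ha ham
      (fun z hz h0 => by simpa [h0] using (norm_nonneg _).trans_lt (h z hz)) hw
  have hle : ∀ w : ℂ, ‖w‖ = 1 → ‖(nInverse m b).eval w‖ ≤ ‖(nInverse m a).eval w‖ := by
    intro w hw
    have := norm_eval_le_of_forall_one_lt (A := X * a) (B := nInverse m b)
      (fun z hz => by simpa using h z hz) hw
    rw [norm_eval_nInverse_of_norm_eq_one ha hw]
    simpa [hw] using this
  rcases eq_C_mul_or_norm_lt_of_norm_le_on_circle hB hle with ⟨c, hc, hG⟩ | hlt
  · left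
    refine ⟨starRingEnd ℂ c, by simpa using hc, ?_⟩
    rw [← nInverse_nInverse m b, hG, nInverse_C_mul, nInverse_nInverse]
  · right
    intro z hz
    have hz0 : z ≠ 0 := by rintro rfl; simp at hz; linarith
    rw [norm_eval_eq_norm_eval_nInverse ha hz0, norm_eval_eq_norm_eval_nInverse hb hz0]
    exact mul_lt_mul_of_pos_left (hlt _ (norm_one_div_conj_lt_one hz)) (by positivity)

/-! ### The operator `Δ_λ^n` and its dual on coefficients -/

/-- The factor by which `Δ_λ^n` multiplies the `k`-th coefficient:
`sin (kλ/2) / sin (nλ/2)`, respectively `k / n` for `λ = 0`. -/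
noncomputable def deltaWeight (n : ℕ) (lam : ℝ) (k : ℕ) : ℝ :=
  if lam = 0 then k / n else Real.sin (k * lam / 2) / Real.sin (n * lam / 2)

theorem mul_lam_div_two_mem {n : ℕ} {lam : ℝ} (hlam0 : 0 < lam) (hlam : lam < 2 * Real.pi / n)
    {k : ℕ} (hk : 0 < k) (hkn : k ≤ n) : 0 < k * lam / 2 ∧ k * lam / 2 < Real.pi := by
  have hk' : (0 : ℝ) < k := by exact_mod_cast hk
  have hkn' : (k : ℝ) ≤ n := by exact_mod_cast hkn
  have hn' : (0 : ℝ) < n := hk'.trans_le hkn'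
  rw [lt_div_iff₀ hn'] at hlam
  constructor
  · positivity
  · nlinarith

theorem sin_mul_lam_div_two_pos {n : ℕ} {lam : ℝ} (hlam0 : 0 < lam)
    (hlam : lam < 2 * Real.pi / n) {k : ℕ} (hk : 0 < k) (hkn : k ≤ n) :
    0 < Real.sin (k * lam / 2) :=
  Real.sin_pos_of_pos_of_lt_pi (mul_lam_div_two_mem hlam0 hlam hk hkn).1
    (mul_lam_div_two_mem hlam0 hlam hk hkn).2

theorem deltaWeight_ne_zero {n : ℕ} {lam : ℝ} (hlam0 : 0 ≤ lam) (hlam : lam < 2 * Real.pi / n)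
    {k : ℕ} (hk : 0 < k) (hkn : k ≤ n) : deltaWeight n lam k ≠ 0 := by
  unfold deltaWeight
  have hn : 0 < n := hk.trans_le hkn
  split_ifs with h0
  · have : (k : ℝ) ≠ 0 := by exact_mod_cast hk.ne'
    have : (n : ℝ) ≠ 0 := by exact_mod_cast hn.ne'
    positivity
  · have hpos := lt_of_le_of_ne hlam0 (Ne.symm h0)
    exact div_ne_zero (sin_mul_lam_div_two_pos hpos hlam hk hkn).ne'
      (sin_mul_lam_div_two_pos hpos hlam hn le_rfl).ne'

theorem coeff_qDelta (n : ℕ) (lam : ℝ) (F : ℂ[X]) (k : ℕ) :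
    (qDelta n lam F).coeff k = deltaWeight n lam (k + 1) * F.coeff (k + 1) := by
  unfold qDelta deltaWeight
  split_ifs with h0
  · rw [coeff_C_mul, coeff_derivative]
    push_cast
    ring
  · rw [coeff_C_mul, coeff_divX, coeff_sub, comp_C_mul_X_coeff, comp_C_mul_X_coeff,
      ← Complex.exp_nat_mul, ← Complex.exp_nat_mul]
    push_cast
    rw [Complex.sin.eq_1 (((k : ℂ) + 1) * lam / 2)]
    rw [show -(((k : ℂ) + 1) * lam / 2) * Complex.I = ((k : ℂ) + 1) * -(Complex.I * lam / 2) by ring,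
      show (((k : ℂ) + 1) * lam / 2) * Complex.I = ((k : ℂ) + 1) * (Complex.I * lam / 2) by ring]
    by_cases hs : Complex.sin (n * lam / 2) = 0
    · simp [hs]
    · field_simp
      rw [Complex.I_sq]
      ring

theorem qDelta_sub (n : ℕ) (lam : ℝ) (F G : ℂ[X]) :
    qDelta n lam (F - G) = qDelta n lam F - qDelta n lam G := by
  ext k
  simp only [coeff_qDelta, coeff_sub]
  ring

theorem qDelta_C_mul (n : ℕ) (lam : ℝ) (c : ℂ) (F : ℂ[X]) :
    qDelta n lam (C c * F) = C c * qDelta n lam F := by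
  ext k
  simp only [coeff_qDelta, coeff_C_mul]
  ring

theorem natDegree_qDelta_le {n : ℕ} (lam : ℝ) {F : ℂ[X]} (hF : F.natDegree ≤ n) :
    (qDelta n lam F).natDegree ≤ n - 1 := by
  refine natDegree_le_iff_coeff_eq_zero.2 fun k hk => ?_
  rw [coeff_qDelta, coeff_eq_zero_of_natDegree_lt (by omega), mul_zero]

theorem coeff_qDelta_top {n : ℕ} (hn : 0 < n) {lam : ℝ} (F : ℂ[X]) :
    (qDelta n lam F).coeff (n - 1) = deltaWeight n lam n * F.coeff n := by
  rw [coeff_qDelta, Nat.sub_add_cancel hn]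

/-- The `(n-1)`-inverse of `Δ_λ^n[F^{*n}]`. -/
noncomputable def dualDelta (n : ℕ) (lam : ℝ) (F : ℂ[X]) : ℂ[X] :=
  nInverse (n - 1) (qDelta n lam (nInverse n F))

theorem coeff_dualDelta {n : ℕ} (hn : 0 < n) (lam : ℝ) {F : ℂ[X]} (hF : F.natDegree ≤ n) (k : ℕ) :
    (dualDelta n lam F).coeff k = deltaWeight n lam (n - k) * F.coeff k := by
  rw [dualDelta, coeff_nInverse, coeff_qDelta, coeff_nInverse]
  simp only [map_mul, Complex.conj_ofReal, Complex.conj_conj]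
  rcases lt_trichotomy k n with hk | rfl | hk
  · rw [revAt_le (show k ≤ n - 1 by omega), show n - 1 - k + 1 = n - k by omega,
      revAt_le (show n - k ≤ n by omega), show n - (n - k) = k by omega]
  · rw [revAt_eq_self_of_lt (show k - 1 < k by omega), revAt_eq_self_of_lt (Nat.lt_succ_self k),
      coeff_eq_zero_of_natDegree_lt (Nat.lt_succ_of_le hF), Nat.sub_self]
    simp [deltaWeight]
  · rw [revAt_eq_self_of_lt (show n - 1 < k by omega), revAt_eq_self_of_lt (show n < k + 1 by omega),
      coeff_eq_zero_of_natDegree_lt (show F.natDegree < k + 1 by omega),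
      coeff_eq_zero_of_natDegree_lt (show F.natDegree < k by omega), mul_zero, mul_zero]

theorem eval_dualDelta {n : ℕ} (hn : 0 < n) {lam : ℝ} (hlam0 : 0 < lam)
    (hlam : lam < 2 * Real.pi / n) {F : ℂ[X]} (hF : F.natDegree ≤ n) (z : ℂ) :
    2 * Complex.I * Real.sin (n * lam / 2) * (dualDelta n lam F).eval z =
      Complex.exp (Complex.I * n * lam / 2) * F.eval (Complex.exp (-(Complex.I * lam / 2)) * z) -
      Complex.exp (-(Complex.I * n * lam / 2)) * F.eval (Complex.exp (Complex.I * lam / 2) * z) := by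
  have hs : (Real.sin (n * lam / 2) : ℂ) ≠ 0 := by
    exact_mod_cast (sin_mul_lam_div_two_pos hlam0 hlam hn le_rfl).ne'
  have key : C (2 * Complex.I * Real.sin (n * lam / 2)) * dualDelta n lam F =
      C (Complex.exp (Complex.I * n * lam / 2)) *
        F.comp (C (Complex.exp (-(Complex.I * lam / 2))) * X) -
      C (Complex.exp (-(Complex.I * n * lam / 2))) *
        F.comp (C (Complex.exp (Complex.I * lam / 2)) * X) := by
    ext k
    rw [coeff_C_mul, coeff_dualDelta hn lam hF, coeff_sub, coeff_C_mul, coeff_C_mul,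
      comp_C_mul_X_coeff, comp_C_mul_X_coeff, ← Complex.exp_nat_mul, ← Complex.exp_nat_mul]
    by_cases hk : k ≤ n
    · rw [deltaWeight, if_neg hlam0.ne', Complex.ofReal_div, Nat.cast_sub hk]
      have h1 : 2 * Complex.I * Real.sin (((n : ℝ) - k) * lam / 2) =
          Complex.exp (Complex.I * n * lam / 2) * Complex.exp (k * -(Complex.I * lam / 2)) -
          Complex.exp (-(Complex.I * n * lam / 2)) * Complex.exp (k * (Complex.I * lam / 2)) := by
        rw [← Complex.exp_add, ← Complex.exp_add, Complex.ofReal_sin, Complex.sin.eq_1]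
        push_cast
        rw [show -(((n : ℂ) - k) * lam / 2) * Complex.I =
            -(Complex.I * n * lam / 2) + k * (Complex.I * lam / 2) by ring,
          show (((n : ℂ) - k) * lam / 2) * Complex.I =
            Complex.I * n * lam / 2 + k * -(Complex.I * lam / 2) by ring]
        linear_combination (Complex.exp (-(Complex.I * n * lam / 2) + k * (Complex.I * lam / 2)) -
          Complex.exp (Complex.I * n * lam / 2 + k * -(Complex.I * lam / 2))) * Complex.I_sq
      have h2 : (Real.sin (n * lam / 2) : ℂ) * (Real.sin (((n : ℝ) - k) * lam / 2) /
          Real.sin (n * lam / 2)) = Real.sin (((n : ℝ) - k) * lam / 2) := by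
        field_simp
      linear_combination F.coeff k * h1 + 2 * Complex.I * F.coeff k * h2
    · rw [coeff_eq_zero_of_natDegree_lt (show F.natDegree < k by omega)]
      ring
  have := congrArg (Polynomial.eval z) key
  simpa [eval_comp] using this

theorem eval_dualDelta_zero {n : ℕ} (hn : 0 < n) {F : ℂ[X]} (hF : F.natDegree ≤ n) (z : ℂ) :
    n * (dualDelta n 0 F).eval z = n * F.eval z - z * (derivative F).eval z := by
  have hn' : (n : ℂ) ≠ 0 := by exact_mod_cast hn.ne'
  have key : C (n : ℂ) * dualDelta n 0 F = C (n : ℂ) * F - X * derivative F := by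
    ext k
    rw [coeff_C_mul, coeff_dualDelta hn 0 hF, coeff_sub, coeff_C_mul, deltaWeight, if_pos rfl]
    by_cases hk : k ≤ n
    · rw [Nat.cast_sub hk]
      rcases k with _ | k
      · simp [hn']
      · rw [coeff_X_mul, coeff_derivative]
        push_cast
        field_simp
    · rcases k with _ | k
      · omega
      · rw [coeff_X_mul, coeff_derivative,
          coeff_eq_zero_of_natDegree_lt (show F.natDegree < k + 1 by omega)]
        ring
  have := congrArg (Polynomial.eval z) key
  simpa using this

/-! ### The classes `D_n(λ)` in terms of `Δ_λ^n` and its dual -/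

/-- The unimodular factors `e^{±iα}` turn the half-plane condition into a comparison of the
distances of `e^{-iα} p / q` to the conjugate points `e^{-iα}` and `e^{iα}`. -/
theorem norm_lt_norm_iff_im_div_pos {α : ℝ} (hα : 0 < Real.sin α) (p q : ℂ) :
    ‖Complex.exp (α * Complex.I) * q - Complex.exp (-(α * Complex.I)) * p‖ < ‖p - q‖ ↔
      0 < (Complex.exp (-(α * Complex.I)) * (p / q)).im := by
  have hid : Complex.normSq (p - q) -
      Complex.normSq (Complex.exp (α * Complex.I) * q - Complex.exp (-(α * Complex.I)) * p) =
      4 * Real.sin α * (Complex.exp (-(α * Complex.I)) * p * starRingEnd ℂ q).im := by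
    have h1 : Complex.exp (-(α * Complex.I)) = ⟨Real.cos α, -Real.sin α⟩ := by
      apply Complex.ext
      · rw [← neg_mul, ← Complex.ofReal_neg, Complex.exp_ofReal_mul_I_re, Real.cos_neg]
      · rw [← neg_mul, ← Complex.ofReal_neg, Complex.exp_ofReal_mul_I_im, Real.sin_neg]
    have h2 : Complex.exp (α * Complex.I) = ⟨Real.cos α, Real.sin α⟩ := by
      apply Complex.ext
      · rw [Complex.exp_ofReal_mul_I_re]
      · rw [Complex.exp_ofReal_mul_I_im]
    rw [h1, h2]
    have h3 := Real.sin_sq_add_cos_sq α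
    set s := Real.sin α
    set c := Real.cos α
    simp only [Complex.normSq_apply, Complex.sub_re, Complex.sub_im, Complex.mul_re,
      Complex.mul_im, Complex.conj_re, Complex.conj_im]
    linear_combination (2 * p.re * q.re + 2 * p.im * q.im -
      (p.re ^ 2 + p.im ^ 2 + q.re ^ 2 + q.im ^ 2)) * h3
  have hdiv : (Complex.exp (-(α * Complex.I)) * (p / q)).im =
      (Complex.exp (-(α * Complex.I)) * p * starRingEnd ℂ q).im / Complex.normSq q := by
    rw [div_eq_mul_inv, Complex.inv_def, ← mul_assoc, ← mul_assoc,
      Complex.im_mul_ofReal, div_eq_mul_inv]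
  rw [← sq_lt_sq₀ (norm_nonneg _) (norm_nonneg _), ← Complex.normSq_eq_norm_sq,
    ← Complex.normSq_eq_norm_sq, ← sub_pos, hid, hdiv]
  by_cases hq : q = 0
  · simp [hq]
  · have hq' : 0 < Complex.normSq q := Complex.normSq_pos.2 hq
    rw [div_pos_iff_of_pos_right hq', mul_pos_iff_of_pos_left (by positivity)]

theorem norm_dualDelta_lt_iff_rotQuot {n : ℕ} (hn : 0 < n) {lam : ℝ} (hlam0 : 0 < lam)
    (hlam : lam < 2 * Real.pi / n) {F : ℂ[X]} (hF : F.natDegree ≤ n) {z : ℂ} (hz : z ≠ 0) :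
    ‖(dualDelta n lam F).eval z‖ < ‖z * (qDelta n lam F).eval z‖ ↔
      0 < (rotQuot n lam F z).im := by
  have hs := sin_mul_lam_div_two_pos hlam0 hlam hn le_rfl
  have hs' : (Real.sin (n * lam / 2) : ℂ) ≠ 0 := by exact_mod_cast hs.ne'
  set N : ℂ := 2 * Complex.I * Real.sin (n * lam / 2) with hN
  have hN0 : N ≠ 0 := by rw [hN]; simp only [ne_eq, mul_eq_zero, hs', Complex.I_ne_zero]; norm_num
  have h1 := eval_dualDelta hn hlam0 hlam hF z
  have h2 : N * (z * (qDelta n lam F).eval z) =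
      F.eval (Complex.exp (Complex.I * lam / 2) * z) -
        F.eval (Complex.exp (-(Complex.I * lam / 2)) * z) := by
    rw [qDelta_eval n lam hlam0.ne' F z hz, hN]
    field_simp
  rw [← mul_lt_mul_iff_right₀ (norm_pos_iff.2 hN0), ← norm_mul, ← norm_mul, h1, h2]
  have h3 : Complex.I * n * lam / 2 = ((n * lam / 2 : ℝ) : ℂ) * Complex.I := by push_cast; ring
  rw [rotQuot, h3]
  exact norm_lt_norm_iff_im_div_pos hs _ _

theorem norm_dualDelta_zero_lt_iff {n : ℕ} (hn : 0 < n) {F : ℂ[X]} (hF : F.natDegree ≤ n) (z : ℂ) :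
    ‖(dualDelta n 0 F).eval z‖ < ‖z * (qDelta n 0 F).eval z‖ ↔
      ‖n * F.eval z - z * (derivative F).eval z‖ < ‖z * (derivative F).eval z‖ := by
  have hn' : (n : ℂ) ≠ 0 := by exact_mod_cast hn.ne'
  have h2 : n * (z * (qDelta n 0 F).eval z) = z * (derivative F).eval z := by
    rw [qDelta, if_pos rfl, eval_mul, eval_C]
    field_simp
  rw [← mul_lt_mul_iff_right₀ (norm_pos_iff.2 hn'), ← norm_mul, ← norm_mul,
    eval_dualDelta_zero hn hF, h2]

/-- Each zero `a` with `|a| < |z|` contributes `Re (z / (z - a)) > 1/2` to `Re (z F'(z) / F(z))`. -/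
theorem norm_lt_of_zeros_norm_lt {n : ℕ} (hn : 0 < n) {F : ℂ[X]} (hF : F.degree = n) {z : ℂ}
    (h : ∀ a ∈ F.roots, ‖a‖ < ‖z‖) :
    ‖n * F.eval z - z * (derivative F).eval z‖ < ‖z * (derivative F).eval z‖ := by
  have hF0 : F ≠ 0 := by rintro rfl; simp at hF
  have hFz : F.eval z ≠ 0 := fun h0 => lt_irrefl _ (h z ((mem_roots hF0).2 h0))
  have hsplit := IsAlgClosed.splits F
  have hcard : Multiset.card F.roots = n := by
    rw [← hsplit.natDegree_eq_card_roots]; exact natDegree_eq_of_degree_eq_some hF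
  have hsum := hsplit.eval_derivative_div_eval_of_ne_zero hFz
  have hterm : ∀ a ∈ F.roots, 1 / 2 < (z * (1 / (z - a))).re := by
    intro a ha
    have hlt := h a ha
    have hne : z - a ≠ 0 := sub_ne_zero.2 fun h => by simp [h] at hlt
    have hpos : 0 < Complex.normSq (z - a) := Complex.normSq_pos.2 hne
    rw [mul_one_div, Complex.div_re, ← add_div, div_lt_div_iff₀ two_pos hpos]
    have h2 : ‖a‖ ^ 2 < ‖z‖ ^ 2 := by gcongr
    rw [← Complex.normSq_eq_norm_sq, ← Complex.normSq_eq_norm_sq] at h2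
    simp only [Complex.normSq_apply, Complex.sub_re, Complex.sub_im] at h2 ⊢
    nlinarith
  set w : ℂ := z * ((derivative F).eval z / F.eval z) with hw
  have hre : (n : ℝ) / 2 < w.re := by
    have h1 : w.re = (F.roots.map fun a => (z * (1 / (z - a))).re).sum := by
      rw [hw, hsum, ← Multiset.sum_map_mul_left, ← Complex.coe_reAddGroupHom, map_multiset_sum,
        Multiset.map_map]
      rfl
    have h2 : (F.roots.map fun _ => (1 / 2 : ℝ)).sum <
        (F.roots.map fun a => (z * (1 / (z - a))).re).sum := by
      refine Multiset.sum_lt_sum_of_nonempty (fun h => ?_) hterm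
      rw [h] at hcard; simp at hcard; omega
    rw [Multiset.map_const', Multiset.sum_replicate, hcard] at h2
    rw [h1]
    simpa [div_eq_mul_inv] using h2
  have hzF : z * (derivative F).eval z = F.eval z * w := by rw [hw]; field_simp
  rw [hzF, show n * F.eval z - F.eval z * w = F.eval z * (n - w) by ring, norm_mul, norm_mul]
  refine mul_lt_mul_of_pos_left ?_ (norm_pos_iff.2 hFz)
  rw [← sq_lt_sq₀ (norm_nonneg _) (norm_nonneg _), ← Complex.normSq_eq_norm_sq,
    ← Complex.normSq_eq_norm_sq]
  simp only [Complex.normSq_apply, Complex.sub_re, Complex.sub_im, Complex.natCast_re,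
    Complex.natCast_im]
  have hn' : (0 : ℝ) < n := by exact_mod_cast hn
  nlinarith

/-! ### Separation of the zeros on the circle -/

theorem one_sub_exp_mul_I (φ : ℝ) : 1 - Complex.exp (φ * Complex.I) =
    (2 * Real.sin (φ / 2) : ℝ) * Complex.exp (((φ - Real.pi) / 2 : ℝ) * Complex.I) := by
  have h1 : Real.cos φ = 1 - 2 * Real.sin (φ / 2) ^ 2 := by
    have h := Real.cos_two_mul (φ / 2)
    rw [mul_div_cancel₀ φ two_ne_zero, Real.cos_sq'] at h
    rw [h]; ring
  have h2 : Real.sin φ = 2 * Real.sin (φ / 2) * Real.cos (φ / 2) := by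
    rw [← Real.sin_two_mul, mul_div_cancel₀ φ two_ne_zero]
  have h3 : Real.cos ((φ - Real.pi) / 2) = Real.sin (φ / 2) := by
    rw [show (φ - Real.pi) / 2 = φ / 2 - Real.pi / 2 by ring, Real.cos_sub_pi_div_two]
  have h4 : Real.sin ((φ - Real.pi) / 2) = -Real.cos (φ / 2) := by
    rw [show (φ - Real.pi) / 2 = φ / 2 - Real.pi / 2 by ring, Real.sin_sub_pi_div_two]
  apply Complex.ext
  · rw [Complex.re_ofReal_mul, Complex.exp_ofReal_mul_I_re, Complex.sub_re, Complex.one_re,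
      Complex.exp_ofReal_mul_I_re, h1, h3]
    ring
  · rw [Complex.im_ofReal_mul, Complex.exp_ofReal_mul_I_im, Complex.sub_im, Complex.one_im,
      Complex.exp_ofReal_mul_I_im, h2, h4]
    ring

theorem arg_one_sub_exp_mul_I {φ : ℝ} (h0 : 0 < φ) (h1 : φ < 2 * Real.pi) :
    Complex.arg (1 - Complex.exp (φ * Complex.I)) = (φ - Real.pi) / 2 := by
  have hs : 0 < Real.sin (φ / 2) := Real.sin_pos_of_pos_of_lt_pi (by linarith) (by linarith)
  rw [one_sub_exp_mul_I, Complex.arg_real_mul _ (by linarith), Complex.arg_exp_mul_I,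
    toIocMod_eq_self]
  constructor <;> linarith

/-- A continuous choice of the argument of the factor `e^{iλ/2} (1 - a u) / (1 - b u)` with
`a = e^{-iλ/2} v` and `b = e^{iλ/2} v`, which a zero `v` of `F` contributes to `rotQuot` at
`1 / u`. -/
noncomputable def factorAngle (lam : ℝ) (v u : ℂ) : ℝ :=
  lam / 2 + Complex.arg (1 - Complex.exp (-(Complex.I * lam / 2)) * v * u) -
    Complex.arg (1 - Complex.exp (Complex.I * lam / 2) * v * u)

theorem norm_exp_I_mul_half (lam : ℝ) : ‖Complex.exp (Complex.I * lam / 2)‖ = 1 := by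
  rw [show Complex.I * lam / 2 = ((lam / 2 : ℝ) : ℂ) * Complex.I by push_cast; ring]
  exact Complex.norm_exp_ofReal_mul_I _

theorem norm_exp_neg_I_mul_half (lam : ℝ) : ‖Complex.exp (-(Complex.I * lam / 2))‖ = 1 := by
  rw [Complex.exp_neg, norm_inv, norm_exp_I_mul_half, inv_one]

theorem factorAngle_zero (lam : ℝ) (v : ℂ) : factorAngle lam v 0 = lam / 2 := by
  simp [factorAngle]

theorem factorAngle_exp (lam ψ : ℝ) {v u : ℂ} (h : v * u = Complex.exp (ψ * Complex.I)) :
    factorAngle lam v u =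
      lam / 2 + Complex.arg (1 - Complex.exp ((ψ - lam / 2 : ℝ) * Complex.I)) -
        Complex.arg (1 - Complex.exp ((ψ + lam / 2 : ℝ) * Complex.I)) := by
  rw [factorAngle, mul_assoc, mul_assoc, h, ← Complex.exp_add, ← Complex.exp_add]
  congr 5
  · push_cast; ring
  · push_cast; ring

/-- On the circle, a zero within angle `λ/2` contributes the boundary value `π`. -/
theorem factorAngle_eq_pi {lam ψ : ℝ} (hlam : lam < 2 * Real.pi) (hψ : |ψ| < lam / 2) {v u : ℂ}
    (h : v * u = Complex.exp (ψ * Complex.I)) : factorAngle lam v u = Real.pi := by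
  rw [abs_lt] at hψ
  have h1 : Complex.exp ((ψ - lam / 2 : ℝ) * Complex.I) =
      Complex.exp ((ψ - lam / 2 + 2 * Real.pi : ℝ) * Complex.I) := by
    rw [Complex.ofReal_add (ψ - lam / 2), add_mul, Complex.exp_add]
    push_cast
    rw [Complex.exp_two_pi_mul_I, mul_one]
  rw [factorAngle_exp lam ψ h, h1, arg_one_sub_exp_mul_I (by linarith) (by linarith),
    arg_one_sub_exp_mul_I (by linarith) (by linarith)]
  ring

/-- On the circle, a zero at an angle greater than `λ/2` contributes the boundary value `0`. -/
theorem factorAngle_eq_zero {lam ψ : ℝ} (hlam0 : 0 < lam) (hψ : lam / 2 < ψ)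
    (hψ' : ψ < 2 * Real.pi - lam / 2) {v u : ℂ}
    (h : v * u = Complex.exp (ψ * Complex.I)) : factorAngle lam v u = 0 := by
  rw [factorAngle_exp lam ψ h, arg_one_sub_exp_mul_I (by linarith) (by linarith),
    arg_one_sub_exp_mul_I (by linarith) (by linarith)]
  ring

theorem factorAngle_nonneg {lam : ℝ} (hlam0 : 0 < lam) (hlam : lam < 2 * Real.pi) {v u : ℂ}
    (hvu : ‖v * u‖ = 1) (ha : Complex.exp (-(Complex.I * lam / 2)) * v * u ≠ 1)
    (hb : Complex.exp (Complex.I * lam / 2) * v * u ≠ 1) : 0 ≤ factorAngle lam v u := by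
  set ψ := Complex.arg (v * u) with hψ
  have hexp : v * u = Complex.exp (ψ * Complex.I) := by
    have := Complex.norm_mul_exp_arg_mul_I (v * u)
    rw [hvu, Complex.ofReal_one, one_mul] at this
    exact this.symm
  have hne1 : ψ ≠ lam / 2 := by
    intro h0
    apply ha
    rw [mul_assoc, hexp, h0, ← Complex.exp_add, ← Complex.exp_zero]
    congr 1; push_cast; ring
  have hne2 : ψ ≠ -(lam / 2) := by
    intro h0
    apply hb
    rw [mul_assoc, hexp, h0, ← Complex.exp_add, ← Complex.exp_zero]
    congr 1; push_cast; ring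
  have hlo := Complex.neg_pi_lt_arg (v * u)
  have hhi := Complex.arg_le_pi (v * u)
  rw [← hψ] at hlo hhi
  rcases lt_or_ge (lam / 2) ψ with h1 | h1
  · exact (factorAngle_eq_zero hlam0 h1 (by linarith) hexp).ge
  rcases lt_or_ge ψ (-(lam / 2)) with h2 | h2
  · refine (factorAngle_eq_zero (ψ := ψ + 2 * Real.pi) hlam0 (by linarith) (by linarith) ?_).ge
    rw [hexp, Complex.ofReal_add, add_mul, Complex.exp_add]
    push_cast
    rw [Complex.exp_two_pi_mul_I, mul_one]
  · rw [factorAngle_eq_pi hlam (abs_lt.2 ⟨lt_of_le_of_ne h2 hne2.symm, lt_of_le_of_ne h1 hne1⟩) hexp]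
    exact Real.pi_pos.le

theorem one_sub_mem_slitPlane {w : ℂ} (hw : ‖w‖ ≤ 1) (hw1 : w ≠ 1) : 1 - w ∈ Complex.slitPlane := by
  left
  rw [Complex.sub_re, Complex.one_re, sub_pos]
  refine lt_of_le_of_ne ((Complex.re_le_norm w).trans hw) fun h => hw1 ?_
  have h1 : ‖w‖ ^ 2 ≤ 1 := by nlinarith [norm_nonneg w]
  rw [← Complex.normSq_eq_norm_sq, Complex.normSq_apply, h] at h1
  apply Complex.ext
  · simpa using h
  · have : w.im * w.im ≤ 0 := by linarith
    simpa using mul_self_eq_zero.1 (le_antisymm this (mul_self_nonneg _))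

theorem ofReal_mul_ne_one {x : ℂ} (hx : ‖x‖ = 1) (hx1 : x ≠ 1) {s : ℝ} (hs : s ∈ Set.Icc (0 : ℝ) 1) :
    x * s ≠ 1 := by
  intro h
  have h1 := congrArg norm h
  rw [norm_mul, hx, one_mul, Complex.norm_real, Real.norm_of_nonneg hs.1, norm_one] at h1
  rw [h1, Complex.ofReal_one, mul_one] at h
  exact hx1 h

theorem norm_mul_ofReal_le_one {x : ℂ} (hx : ‖x‖ = 1) {s : ℝ} (hs : s ∈ Set.Icc (0 : ℝ) 1) :
    ‖x * s‖ ≤ 1 := by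
  rw [norm_mul, hx, one_mul, Complex.norm_real, Real.norm_of_nonneg hs.1]
  exact hs.2

theorem continuousOn_factorAngle (lam : ℝ) {v ζ : ℂ} (hv : ‖v‖ = 1) (hζ : ‖ζ‖ = 1)
    (ha : Complex.exp (-(Complex.I * lam / 2)) * v * ζ ≠ 1)
    (hb : Complex.exp (Complex.I * lam / 2) * v * ζ ≠ 1) :
    ContinuousOn (fun s : ℝ => factorAngle lam v (ζ * s)) (Set.Icc 0 1) := by
  have key : ∀ x : ℂ, ‖x‖ = 1 → x ≠ 1 →
      ContinuousOn (fun s : ℝ => Complex.arg (1 - x * s)) (Set.Icc 0 1) := by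
    intro x hx hx1 s hs
    have hmem := one_sub_mem_slitPlane (norm_mul_ofReal_le_one hx hs) (ofReal_mul_ne_one hx hx1 hs)
    have hc : ContinuousAt (fun s : ℝ => 1 - x * (s : ℂ)) s := by fun_prop
    exact (ContinuousAt.comp (g := Complex.arg) (f := fun s : ℝ => 1 - x * (s : ℂ))
      (Complex.continuousAt_arg hmem) hc).continuousWithinAt
  unfold factorAngle
  simp only [← mul_assoc]
  exact (continuousOn_const.add (key _ (by simp [hv, hζ, norm_exp_neg_I_mul_half]) ha)).sub
    (key _ (by simp [hv, hζ, norm_exp_I_mul_half]) hb)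

theorem continuousOn_sum_factorAngle (lam : ℝ) {ζ : ℂ} (hζ : ‖ζ‖ = 1) (S : Multiset ℂ)
    (hS : ∀ v ∈ S, ‖v‖ = 1 ∧ Complex.exp (-(Complex.I * lam / 2)) * v * ζ ≠ 1 ∧
      Complex.exp (Complex.I * lam / 2) * v * ζ ≠ 1) :
    ContinuousOn (fun s : ℝ => (S.map fun v => factorAngle lam v (ζ * s)).sum) (Set.Icc 0 1) := by
  induction S using Multiset.induction with
  | empty => simpa using continuousOn_const
  | cons a S ih =>
    obtain ⟨h1, h2, h3⟩ := hS a (Multiset.mem_cons_self a S)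
    simp only [Multiset.map_cons, Multiset.sum_cons]
    exact (continuousOn_factorAngle lam h1 hζ h2 h3).add
      (ih fun v hv => hS v (Multiset.mem_cons_of_mem hv))

theorem exists_factor_eq {lam : ℝ} {v u : ℂ} (hv : ‖v‖ = 1) (hu : ‖u‖ < 1) :
    ∃ r : ℝ, 0 < r ∧ Complex.exp (Complex.I * lam / 2) *
      ((1 - Complex.exp (-(Complex.I * lam / 2)) * v * u) /
        (1 - Complex.exp (Complex.I * lam / 2) * v * u)) =
      r * Complex.exp (factorAngle lam v u * Complex.I) := by
  set x := 1 - Complex.exp (-(Complex.I * lam / 2)) * v * u with hx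
  set y := 1 - Complex.exp (Complex.I * lam / 2) * v * u with hy
  have hne : ∀ w : ℂ, ‖w‖ < 1 → 1 - w ≠ 0 := fun w hw h => by
    rw [← sub_eq_zero.1 h] at hw; simp at hw
  have hx0 : x ≠ 0 := hne _ (by rw [norm_mul, norm_mul, hv, norm_exp_neg_I_mul_half]; simpa)
  have hy0 : y ≠ 0 := hne _ (by rw [norm_mul, norm_mul, hv, norm_exp_I_mul_half]; simpa)
  refine ⟨‖x‖ / ‖y‖, div_pos (norm_pos_iff.2 hx0) (norm_pos_iff.2 hy0), ?_⟩
  have hy0' : (‖y‖ : ℂ) ≠ 0 := by exact_mod_cast norm_ne_zero_iff.2 hy0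
  rw [factorAngle, ← hx, ← hy]
  conv_lhs => rw [← Complex.norm_mul_exp_arg_mul_I x, ← Complex.norm_mul_exp_arg_mul_I y]
  push_cast
  rw [show ((lam : ℂ) / 2 + Complex.arg x - Complex.arg y) * Complex.I =
      Complex.I * lam / 2 + Complex.arg x * Complex.I - Complex.arg y * Complex.I by ring,
    Complex.exp_sub, Complex.exp_add]
  field_simp

theorem exists_prod_eq {ι : Type*} (S : Multiset ι) (f : ι → ℂ) (θ : ι → ℝ)
    (h : ∀ v ∈ S, ∃ r : ℝ, 0 < r ∧ f v = r * Complex.exp (θ v * Complex.I)) :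
    ∃ r : ℝ, 0 < r ∧ (S.map f).prod = r * Complex.exp ((S.map θ).sum * Complex.I) := by
  induction S using Multiset.induction with
  | empty => exact ⟨1, one_pos, by simp⟩
  | cons a S ih =>
    obtain ⟨r, hr, h1⟩ := h a (Multiset.mem_cons_self a S)
    obtain ⟨r', hr', h2⟩ := ih fun v hv => h v (Multiset.mem_cons_of_mem hv)
    refine ⟨r * r', mul_pos hr hr', ?_⟩
    rw [Multiset.map_cons, Multiset.prod_cons, Multiset.map_cons, Multiset.sum_cons, h1, h2]
    push_cast
    rw [add_mul, Complex.exp_add]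
    ring

theorem prod_rotation_quotient (S : Multiset ℂ) (lam : ℝ) {u : ℂ} (hu0 : u ≠ 0) :
    Complex.exp (-(Complex.I * (Multiset.card S : ℕ) * lam / 2)) *
      ((S.map fun v => Complex.exp (Complex.I * lam / 2) * u⁻¹ - v).prod /
        (S.map fun v => Complex.exp (-(Complex.I * lam / 2)) * u⁻¹ - v).prod) =
      (S.map fun v => Complex.exp (Complex.I * lam / 2) *
        ((1 - Complex.exp (-(Complex.I * lam / 2)) * v * u) /
          (1 - Complex.exp (Complex.I * lam / 2) * v * u))).prod := by
  induction S using Multiset.induction with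
  | empty => simp
  | cons a S ih =>
    rw [Multiset.map_cons, Multiset.prod_cons, Multiset.map_cons, Multiset.prod_cons,
      Multiset.map_cons, Multiset.prod_cons, ← ih, Multiset.card_cons]
    set e := Complex.exp (Complex.I * lam / 2) with he
    have he' : Complex.exp (-(Complex.I * lam / 2)) = e⁻¹ := Complex.exp_neg _
    have he0 : e ≠ 0 := Complex.exp_ne_zero _
    have h1 : Complex.exp (-(Complex.I * ((Multiset.card S + 1 : ℕ) : ℂ) * lam / 2)) =
        Complex.exp (-(Complex.I * (Multiset.card S : ℕ) * lam / 2)) * e⁻¹ := by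
      rw [← he', ← Complex.exp_add]
      congr 1; push_cast; ring
    have hx : e * u⁻¹ - a = e * u⁻¹ * (1 - e⁻¹ * a * u) := by field_simp
    have hy : e⁻¹ * u⁻¹ - a = e⁻¹ * u⁻¹ * (1 - e * a * u) := by field_simp
    rw [h1, he', hx, hy, mul_div_mul_comm, mul_div_mul_comm, mul_div_mul_comm]
    have h2 : e⁻¹ * (e / e⁻¹ * (u⁻¹ / u⁻¹)) = e := by field_simp
    linear_combination (Complex.exp (-(Complex.I * (Multiset.card S : ℕ) * lam / 2)) *
      ((1 - e⁻¹ * a * u) / (1 - e * a * u)) *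
      ((S.map fun v => e * u⁻¹ - v).prod / (S.map fun v => e⁻¹ * u⁻¹ - v).prod)) * h2

theorem rotQuot_inv {n : ℕ} {lam : ℝ} {F : ℂ[X]} (hF : F.degree = n) {u : ℂ} (hu0 : u ≠ 0) :
    rotQuot n lam F u⁻¹ = (F.roots.map fun v => Complex.exp (Complex.I * lam / 2) *
        ((1 - Complex.exp (-(Complex.I * lam / 2)) * v * u) /
          (1 - Complex.exp (Complex.I * lam / 2) * v * u))).prod := by
  have hF0 : F ≠ 0 := by rintro rfl; simp at hF
  have hsplit := IsAlgClosed.splits F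
  have hcard : Multiset.card F.roots = n := by
    rw [← hsplit.natDegree_eq_card_roots]; exact natDegree_eq_of_degree_eq_some hF
  have hl : F.leadingCoeff ≠ 0 := leadingCoeff_ne_zero.2 hF0
  rw [← prod_rotation_quotient F.roots lam hu0, hcard, rotQuot, hsplit.eval_eq_prod_roots,
    hsplit.eval_eq_prod_roots, mul_div_mul_left _ _ hl]

/-- The total angle starts at `nλ/2` in the centre and cannot leave `(0, π)` along a radius, as the
quotient stays in the upper half-plane. -/
theorem sum_factorAngle_le_pi {n : ℕ} (hn : 0 < n) {lam : ℝ} (hlam0 : 0 < lam)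
    (hlam : lam < 2 * Real.pi / n) {F : ℂ[X]} (hF : F ∈ zerosIn n unitCircle)
    (h : ∀ z : ℂ, 1 < ‖z‖ → 0 < (rotQuot n lam F z).im) {ζ : ℂ} (hζ : ‖ζ‖ = 1)
    (hgen : ∀ v ∈ F.roots, Complex.exp (-(Complex.I * lam / 2)) * v * ζ ≠ 1 ∧
      Complex.exp (Complex.I * lam / 2) * v * ζ ≠ 1) :
    (F.roots.map fun v => factorAngle lam v ζ).sum ≤ Real.pi := by
  obtain ⟨hdeg, hroots⟩ := hF
  have hF0 : F ≠ 0 := by rintro rfl; simp at hdeg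
  have hnorm : ∀ v ∈ F.roots, ‖v‖ = 1 := fun v hv => hroots v ((mem_roots hF0).1 hv)
  have hcard : Multiset.card F.roots = n := by
    rw [← (IsAlgClosed.splits F).natDegree_eq_card_roots]
    exact natDegree_eq_of_degree_eq_some hdeg
  set Θ : ℝ → ℝ := fun s => (F.roots.map fun v => factorAngle lam v (ζ * s)).sum with hΘ
  have hcont : ContinuousOn Θ (Set.Icc 0 1) :=
    continuousOn_sum_factorAngle lam hζ F.roots fun v hv => ⟨hnorm v hv, hgen v hv⟩
  have hΘ0 : Θ 0 = n * lam / 2 := by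
    simp only [hΘ, Complex.ofReal_zero, mul_zero, factorAngle_zero]
    rw [Multiset.map_const', Multiset.sum_replicate, hcard, nsmul_eq_mul]
    ring
  have hΘ1 : Θ 1 = (F.roots.map fun v => factorAngle lam v ζ).sum := by simp [hΘ]
  have hstart := mul_lam_div_two_mem hlam0 hlam hn le_rfl
  rw [← hΘ1]
  by_contra! hgt
  obtain ⟨s, hs, hsπ⟩ := intermediate_value_Icc zero_le_one hcont
    (show Real.pi ∈ Set.Icc (Θ 0) (Θ 1) from ⟨by rw [hΘ0]; exact hstart.2.le, hgt.le⟩)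
  have hs0 : s ≠ 0 := by rintro rfl; rw [hΘ0] at hsπ; linarith [hstart.2]
  have hs1 : s ≠ 1 := by rintro rfl; linarith
  have hs0' : 0 < s := lt_of_le_of_ne hs.1 hs0.symm
  have hs1' : s < 1 := lt_of_le_of_ne hs.2 hs1
  have hu : ‖ζ * s‖ = s := by
    rw [norm_mul, hζ, one_mul, Complex.norm_real, Real.norm_of_nonneg hs.1]
  have hu0 : ζ * s ≠ 0 := by rw [← norm_ne_zero_iff, hu]; exact hs0
  have hpos := h (ζ * s)⁻¹ (by rw [norm_inv, hu]; exact (one_lt_inv₀ hs0').2 hs1')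
  rw [rotQuot_inv hdeg hu0] at hpos
  obtain ⟨r, hr, hprod⟩ := exists_prod_eq F.roots _ (fun v => factorAngle lam v (ζ * s))
    fun v hv => exists_factor_eq (lam := lam) (hnorm v hv) (show ‖ζ * s‖ < 1 by rwa [hu])
  rw [hprod, Complex.im_ofReal_mul, Complex.exp_ofReal_mul_I_im,
    show (F.roots.map fun v => factorAngle lam v (ζ * s)).sum = Real.pi from hsπ, Real.sin_pi,
    mul_zero] at hpos
  exact lt_irrefl _ hpos

/-- A point of the circle close to the middle of the arc between two given points. -/
theorem exists_unit_near_midpoint {lam : ℝ} {v w : ℂ} (hv : ‖v‖ = 1) (hw : ‖w‖ = 1)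
    (h : |Complex.arg (v / w)| < lam) (bad : Finset ℂ) :
    ∃ ζ : ℂ, ‖ζ‖ = 1 ∧ ζ ∉ bad ∧
      (∃ ψ : ℝ, |ψ| < lam / 2 ∧ v * ζ = Complex.exp (ψ * Complex.I)) ∧
      ∃ ψ : ℝ, |ψ| < lam / 2 ∧ w * ζ = Complex.exp (ψ * Complex.I) := by
  set δ := Complex.arg (v / w) with hδ
  have hw0 : w ≠ 0 := by rintro rfl; simp at hw
  have hvw : v = w * Complex.exp (δ * Complex.I) := by
    have := Complex.norm_mul_exp_arg_mul_I (v / w)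
    rw [norm_div, hv, hw, div_one, Complex.ofReal_one, one_mul, ← hδ] at this
    rw [this]; field_simp
  set η : ℝ := min ((lam - |δ|) / 2) 1 with hη
  have hη0 : 0 < η := lt_min (by linarith) one_pos
  set g : ℝ → ℂ := fun ε => w⁻¹ * Complex.exp ((ε - δ / 2 : ℝ) * Complex.I) with hg
  have hinj : Set.InjOn g (Set.Ioo 0 η) := by
    intro x hx y hy hxy
    have h1 := mul_left_cancel₀ (inv_ne_zero hw0) hxy
    have h2 : Complex.exp ((x : ℂ) * Complex.I) = Complex.exp ((y : ℂ) * Complex.I) := by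
      have h3 := congrArg (· * Complex.exp ((δ / 2 : ℝ) * Complex.I)) h1
      simp only [← Complex.exp_add, ← add_mul, ← Complex.ofReal_add, sub_add_cancel] at h3
      exact h3
    have hη1 : η ≤ 1 := min_le_right _ _
    have hpi := Real.pi_gt_three
    have := Complex.exp_inj_of_neg_pi_lt_of_le_pi (x := x * Complex.I) (y := y * Complex.I)
      (by simp; linarith [hx.1]) (by simp; linarith [hx.2]) (by simp; linarith [hy.1])
      (by simp; linarith [hy.2]) h2
    exact_mod_cast mul_right_cancel₀ Complex.I_ne_zero this
  obtain ⟨ζ, ⟨ε, hε, rfl⟩, hbad⟩ :=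
    ((Set.Ioo_infinite hη0).image hinj).exists_notMem_finset bad
  have hεη : ε < (lam - |δ|) / 2 := hε.2.trans_le (min_le_left _ _)
  have habs := abs_le.1 (le_refl |δ|)
  refine ⟨g ε, ?_, hbad, ⟨ε + δ / 2, ?_, ?_⟩, ⟨ε - δ / 2, ?_, ?_⟩⟩
  · simp only [hg, norm_mul, norm_inv, hw, Complex.norm_exp_ofReal_mul_I]; simp
  · rw [abs_lt]; constructor <;> linarith [hε.1]
  · rw [hvw]
    simp only [hg]
    rw [show w * Complex.exp (δ * Complex.I) *
        (w⁻¹ * Complex.exp ((ε - δ / 2 : ℝ) * Complex.I)) =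
        w * w⁻¹ * (Complex.exp (δ * Complex.I) * Complex.exp ((ε - δ / 2 : ℝ) * Complex.I)) by ring,
      mul_inv_cancel₀ hw0, one_mul, ← Complex.exp_add]
    congr 1; push_cast; ring
  · rw [abs_lt]; constructor <;> linarith [hε.1]
  · simp only [hg]
    rw [mul_inv_cancel_left₀ hw0]

/-- Two zeros at an angle less than `λ` would push the total angle up to `2π`. -/
theorem mem_TBar_of_im_rotQuot_pos {n : ℕ} (hn : 0 < n) {lam : ℝ} (hlam0 : 0 < lam)
    (hlam : lam < 2 * Real.pi / n) {F : ℂ[X]} (hF : F ∈ zerosIn n unitCircle)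
    (h : ∀ z : ℂ, 1 < ‖z‖ → 0 < (rotQuot n lam F z).im) : F ∈ TBar n lam := by
  refine ⟨hF, fun v hv w hw => ?_⟩
  by_contra! hlt
  have hF0 : F ≠ 0 := by rintro rfl; simp at hv
  have hnorm : ∀ v ∈ F.roots, ‖v‖ = 1 := fun v hv => hF.2 v ((mem_roots hF0).1 hv)
  have hlam2 : lam < 2 * Real.pi := by
    have := mul_lam_div_two_mem hlam0 hlam Nat.one_pos hn
    push_cast at this
    linarith [this.2]
  set e := Complex.exp (Complex.I * lam / 2) with he
  set e' := Complex.exp (-(Complex.I * lam / 2)) with he'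
  obtain ⟨ζ, hζ, hbad, ⟨ψ, hψ, hvζ⟩, ⟨ψ', hψ', hwζ⟩⟩ :=
    exists_unit_near_midpoint (hnorm v hv) (hnorm w (Multiset.mem_of_mem_erase hw)) hlt
      (F.roots.toFinset.image (fun x => (e' * x)⁻¹) ∪ F.roots.toFinset.image fun x => (e * x)⁻¹)
  have hgen : ∀ x ∈ F.roots, e' * x * ζ ≠ 1 ∧ e * x * ζ ≠ 1 := by
    intro x hx
    constructor
    · intro h1
      refine hbad (Finset.mem_union_left _ (Finset.mem_image.2 ⟨x, by simpa using hx, ?_⟩))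
      exact (eq_inv_of_mul_eq_one_right h1).symm
    · intro h1
      refine hbad (Finset.mem_union_right _ (Finset.mem_image.2 ⟨x, by simpa using hx, ?_⟩))
      exact (eq_inv_of_mul_eq_one_right h1).symm
  have hle := sum_factorAngle_le_pi hn hlam0 hlam hF h hζ hgen
  have hsplit : F.roots = v ::ₘ w ::ₘ (F.roots.erase v).erase w := by
    rw [Multiset.cons_erase hw, Multiset.cons_erase hv]
  rw [hsplit, Multiset.map_cons, Multiset.sum_cons, Multiset.map_cons, Multiset.sum_cons,
    factorAngle_eq_pi hlam2 hψ hvζ, factorAngle_eq_pi hlam2 hψ' hwζ] at hle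
  have hrest : 0 ≤ (((F.roots.erase v).erase w).map fun x => factorAngle lam x ζ).sum := by
    refine Multiset.sum_nonneg fun y hy => ?_
    obtain ⟨x, hx, rfl⟩ := Multiset.mem_map.1 hy
    have hx' := Multiset.mem_of_mem_erase (Multiset.mem_of_mem_erase hx)
    refine factorAngle_nonneg hlam0 hlam2 ?_ (hgen x hx').1 (hgen x hx').2
    rw [norm_mul, hnorm x hx', hζ, one_mul]
  linarith [Real.pi_pos]

/-! ### The classes and the comparison of `Δ_λ^n[F]` with `Δ_λ^n[F^{*n}]` -/

theorem mem_DBar_iff {n : ℕ} (hn : 0 < n) {lam : ℝ} (hlam0 : 0 ≤ lam)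
    (hlam : lam < 2 * Real.pi / n) {F : ℂ[X]} :
    F ∈ DBar n lam ↔ F.degree = n ∧ ∀ z : ℂ, 1 < ‖z‖ →
      ‖(dualDelta n lam F).eval z‖ < ‖z * (qDelta n lam F).eval z‖ := by
  have hz0 : ∀ z : ℂ, 1 < ‖z‖ → z ≠ 0 := fun z hz h => by simp [h] at hz; linarith
  unfold DBar
  split_ifs with h0
  · subst h0
    refine and_congr_right fun hdeg => ?_
    have hF0 : F ≠ 0 := by rintro rfl; simp at hdeg
    have hnd : F.natDegree ≤ n := (natDegree_eq_of_degree_eq_some hdeg).le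
    simp only [norm_dualDelta_zero_lt_iff hn hnd]
    constructor
    · intro h z hz
      exact norm_lt_of_zeros_norm_lt hn hdeg fun a ha => (h a ((mem_roots hF0).1 ha)).trans_lt hz
    · intro h z hz
      by_contra hz1
      have := h z (not_le.1 hz1)
      rw [show F.eval z = 0 from hz, mul_zero, zero_sub, norm_neg] at this
      exact lt_irrefl _ this
  · refine and_congr_right fun hdeg => ?_
    have hnd : F.natDegree ≤ n := (natDegree_eq_of_degree_eq_some hdeg).le
    refine forall₂_congr fun z hz => ?_
    rw [norm_dualDelta_lt_iff_rotQuot hn (lt_of_le_of_ne hlam0 (Ne.symm h0)) hlam hnd (hz0 z hz)]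

theorem mem_DOpen_diff_TOpen_iff {n : ℕ} (hn : 0 < n) {lam : ℝ} (hlam0 : 0 ≤ lam)
    (hlam : lam < 2 * Real.pi / n) {F : ℂ[X]} :
    F ∈ DOpen n lam \ TOpen n lam ↔ F ∉ TOpen n lam ∧ F.degree = n ∧ ∀ z : ℂ, 1 ≤ ‖z‖ →
      ‖(dualDelta n lam F).eval z‖ < ‖z * (qDelta n lam F).eval z‖ := by
  have hz0 : ∀ z : ℂ, 1 ≤ ‖z‖ → z ≠ 0 := fun z hz h => by simp [h] at hz; linarith
  rw [Set.mem_sdiff, and_comm]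
  refine and_congr_right fun hT => ?_
  unfold DOpen
  split_ifs with h0
  · subst h0
    rw [Set.mem_union, or_iff_left hT]
    refine and_congr_right fun hdeg => ?_
    have hF0 : F ≠ 0 := by rintro rfl; simp at hdeg
    have hnd : F.natDegree ≤ n := (natDegree_eq_of_degree_eq_some hdeg).le
    simp only [norm_dualDelta_zero_lt_iff hn hnd]
    constructor
    · intro h z hz
      exact norm_lt_of_zeros_norm_lt hn hdeg fun a ha => (h a ((mem_roots hF0).1 ha)).trans_le hz
    · intro h z hz
      by_contra hz1
      have := h z (not_lt.1 hz1)
      rw [show F.eval z = 0 from hz, mul_zero, zero_sub, norm_neg] at this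
      exact lt_irrefl _ this
  · rw [Set.mem_union, or_iff_right hT]
    refine and_congr_right fun hdeg => ?_
    have hnd : F.natDegree ≤ n := (natDegree_eq_of_degree_eq_some hdeg).le
    refine forall₂_congr fun z hz => ?_
    rw [norm_dualDelta_lt_iff_rotQuot hn (lt_of_le_of_ne hlam0 (Ne.symm h0)) hlam hnd (hz0 z hz)]

theorem DBar_subset_zerosIn_closedDisk (n : ℕ) (lam : ℝ) : DBar n lam ⊆ zerosIn n closedDisk := by
  intro F hF
  unfold DBar at hF
  split_ifs at hF with h0
  · exact hF
  · refine ⟨hF.1, fun x hx => ?_⟩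
    by_contra hx1
    have hx1 : 1 < ‖x‖ := not_le.1 hx1
    have h1 := hF.2 (Complex.exp (Complex.I * lam / 2) * x)
      (by rwa [norm_mul, norm_exp_I_mul_half, one_mul])
    -- At this point the denominator of the quotient is `F x = 0`.
    rw [rotQuot, ← mul_assoc (Complex.exp (-(Complex.I * lam / 2))), ← Complex.exp_add,
      neg_add_cancel, Complex.exp_zero, one_mul, show F.eval x = 0 from hx, div_zero] at h1
    simp at h1

theorem exists_nInverse_eq_C_mul {n : ℕ} {F : ℂ[X]} (hF : F ∈ zerosIn n unitCircle) :
    ∃ c : ℂ, ‖c‖ = 1 ∧ nInverse n F = C c * F := by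
  obtain ⟨p, ⟨⟨t, -, -, rfl⟩, hp⟩, -⟩ := existsUnique_isPhase n F hF
  set p := Complex.exp (t * Complex.I) with hpdef
  have hp1 : ‖p‖ = 1 := Complex.norm_exp_ofReal_mul_I t
  have hpp : p * starRingEnd ℂ p = 1 := by
    rw [Complex.mul_conj, Complex.normSq_eq_norm_sq, hp1]; simp
  refine ⟨p * p, by simp [hp1], ?_⟩
  rw [nInverse_C_mul] at hp
  have h1 : (C p * C (starRingEnd ℂ p) : ℂ[X]) = 1 := by rw [← C_mul, hpp, C_1]
  rw [C_mul]
  linear_combination C p * hp - nInverse n F * h1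

theorem norm_qDelta_nInverse_eq {n : ℕ} (lam : ℝ) {F : ℂ[X]} (hF : F ∈ zerosIn n unitCircle)
    (z : ℂ) : ‖(qDelta n lam (nInverse n F)).eval z‖ = ‖(qDelta n lam F).eval z‖ := by
  obtain ⟨c, hc, h⟩ := exists_nInverse_eq_C_mul hF
  rw [h, qDelta_C_mul, eval_mul, eval_C, norm_mul, hc, one_mul]

/-- `Δ_λ^n` loses only the constant term, which self-inversiveness recovers from the leading
coefficient. -/
theorem nInverse_eq_C_mul_of_qDelta_eq {n : ℕ} (hn : 0 < n) {lam : ℝ} (hlam0 : 0 ≤ lam)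
    (hlam : lam < 2 * Real.pi / n) {F : ℂ[X]} (hF : F.natDegree ≤ n) {c : ℂ} (hc : ‖c‖ = 1)
    (h : qDelta n lam (nInverse n F) = C c * qDelta n lam F) : nInverse n F = C c * F := by
  have hcc : c * starRingEnd ℂ c = 1 := by
    rw [Complex.mul_conj, Complex.normSq_eq_norm_sq, hc]; simp
  have hpos : ∀ k, 0 < k → k ≤ n → (nInverse n F).coeff k = c * F.coeff k := by
    intro k hk hkn
    have h1 := congrArg (fun p : ℂ[X] => p.coeff (k - 1)) h
    simp only [coeff_C_mul, coeff_qDelta, Nat.sub_add_cancel hk] at h1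
    have hw : (deltaWeight n lam k : ℂ) ≠ 0 := by
      exact_mod_cast deltaWeight_ne_zero hlam0 hlam hk hkn
    refine mul_left_cancel₀ hw ?_
    rw [h1]; ring
  ext k
  rw [coeff_C_mul]
  rcases Nat.eq_zero_or_pos k with rfl | hk
  · have htop := hpos n hn le_rfl
    rw [coeff_nInverse, revAt_le le_rfl, Nat.sub_self] at htop
    have h2 := congrArg (starRingEnd ℂ) htop
    rw [Complex.conj_conj, map_mul] at h2
    rw [coeff_nInverse, revAt_le (Nat.zero_le n), Nat.sub_zero, h2, ← mul_assoc, hcc, one_mul]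
  · rcases le_or_gt k n with hkn | hkn
    · exact hpos k hk hkn
    · rw [coeff_eq_zero_of_natDegree_lt ((natDegree_nInverse_le hF).trans_lt hkn),
        coeff_eq_zero_of_natDegree_lt (hF.trans_lt hkn), mul_zero]

theorem mem_zerosIn_unitCircle_of_closedDisk {n : ℕ} {F : ℂ[X]} (hF : F ∈ zerosIn n closedDisk)
    (hF' : nInverse n F ∈ zerosIn n closedDisk) : F ∈ zerosIn n unitCircle := by
  refine ⟨hF.1, fun z hz => le_antisymm (hF.2 z hz) ?_⟩
  have hnd : F.natDegree ≤ n := (natDegree_eq_of_degree_eq_some hF.1).le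
  have hz0 : z ≠ 0 := by
    -- The value of `F` at `0` is conjugate to the leading coefficient of `F^{*n}`.
    rintro rfl
    have h1 := coeff_ne_zero_of_eq_degree hF'.1
    rw [coeff_nInverse, revAt_le le_rfl, Nat.sub_self, coeff_zero_eq_eval_zero,
      show F.eval 0 = 0 from hz] at h1
    simp at h1
  have h1 : (nInverse n F).IsRoot (1 / starRingEnd ℂ z) := by
    have hw0 : 1 / starRingEnd ℂ z ≠ 0 := by simpa using hz0
    rw [IsRoot, nInverse_eval n F hnd _ hw0]
    simp [show F.eval z = 0 from hz]
  have h2 : ‖1 / starRingEnd ℂ z‖ ≤ 1 := hF'.2 _ h1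
  rw [norm_one_div_conj] at h2
  exact (inv_le_one₀ (norm_pos_iff.2 hz0)).1 h2

theorem C_mul_mem_zerosIn {n : ℕ} {Ω : Set ℂ} {F : ℂ[X]} (hF : F ∈ zerosIn n Ω) {c : ℂ}
    (hc : c ≠ 0) : C c * F ∈ zerosIn n Ω := by
  refine ⟨by rw [degree_C_mul hc, hF.1], fun z hz => hF.2 z ?_⟩
  simpa [IsRoot, hc] using hz

/-- A self-inversive member of `DBar` has its zeros on the circle, where they are separated. -/
theorem mem_TBar_of_nInverse_eq_C_mul {n : ℕ} (hn : 0 < n) {lam : ℝ} (hlam0 : 0 ≤ lam)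
    (hlam : lam < 2 * Real.pi / n) {F : ℂ[X]} (hF : F ∈ DBar n lam) {c : ℂ} (hc : ‖c‖ = 1)
    (h : nInverse n F = C c * F) : F ∈ TBar n lam := by
  have hcd := DBar_subset_zerosIn_closedDisk n lam hF
  have hc0 : c ≠ 0 := by rintro rfl; simp at hc
  have huc := mem_zerosIn_unitCircle_of_closedDisk hcd (by rw [h]; exact C_mul_mem_zerosIn hcd hc0)
  rcases hlam0.eq_or_lt with h0 | h0
  · exact ⟨huc, fun z _ w _ => by rw [← h0]; exact abs_nonneg _⟩
  · rw [DBar, if_neg h0.ne'] at hF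
    exact mem_TBar_of_im_rotQuot_pos hn h0 hlam huc hF.2

theorem coeff_qDelta_top_ne_zero {n : ℕ} (hn : 0 < n) {lam : ℝ} (hlam0 : 0 ≤ lam)
    (hlam : lam < 2 * Real.pi / n) {F : ℂ[X]} :
    (qDelta n lam F).coeff (n - 1) ≠ 0 ↔ F.coeff n ≠ 0 := by
  have hw : (deltaWeight n lam n : ℂ) ≠ 0 := by
    exact_mod_cast deltaWeight_ne_zero hlam0 hlam hn le_rfl
  rw [coeff_qDelta_top hn, mul_ne_zero_iff, and_iff_right hw]

theorem coeff_ne_zero_of_norm_qDelta_lt {n : ℕ} (hn : 0 < n) {lam : ℝ} (hlam0 : 0 ≤ lam)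
    (hlam : lam < 2 * Real.pi / n) {F : ℂ[X]} (hF : F.natDegree ≤ n)
    (hne : F.coeff n ≠ 0 ∨ F.coeff 0 ≠ 0)
    (h : ∀ z : ℂ, 1 < ‖z‖ →
      ‖(qDelta n lam (nInverse n F)).eval z‖ < ‖(qDelta n lam F).eval z‖) : F.coeff n ≠ 0 := by
  refine hne.elim id fun h0 => (coeff_qDelta_top_ne_zero hn hlam0 hlam).1 ?_
  have h1 := norm_coeff_le_of_forall_one_lt (natDegree_qDelta_le lam hF)
    (natDegree_qDelta_le lam (natDegree_nInverse_le hF)) h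
  have h2 : (qDelta n lam (nInverse n F)).coeff (n - 1) ≠ 0 := by
    rw [coeff_qDelta_top_ne_zero hn hlam0 hlam, coeff_nInverse, revAt_le le_rfl, Nat.sub_self]
    simpa using h0
  exact norm_pos_iff.1 ((norm_pos_iff.2 h2).trans_le h1)

theorem mem_DBar_diff_TBar_iff {n : ℕ} (hn : 0 < n) {lam : ℝ} (hlam0 : 0 ≤ lam)
    (hlam : lam < 2 * Real.pi / n) {F : ℂ[X]} (hF : F.natDegree ≤ n)
    (hne : F.coeff n ≠ 0 ∨ F.coeff 0 ≠ 0) :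
    F ∈ DBar n lam \ TBar n lam ↔ ∀ z : ℂ, 1 < ‖z‖ →
      ‖(qDelta n lam (nInverse n F)).eval z‖ < ‖(qDelta n lam F).eval z‖ := by
  have ha := natDegree_qDelta_le lam hF
  have hb := natDegree_qDelta_le lam (natDegree_nInverse_le hF)
  constructor
  · rintro ⟨hD, hT⟩
    have hD' := (mem_DBar_iff hn hlam0 hlam).1 hD
    have ham := (coeff_qDelta_top_ne_zero hn hlam0 hlam).2 (coeff_ne_zero_of_eq_degree hD'.1)
    rcases eq_C_mul_or_norm_lt_of_norm_nInverse_lt ha hb ham hD'.2 with ⟨c, hc, h⟩ | h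
    · exact absurd (mem_TBar_of_nInverse_eq_C_mul hn hlam0 hlam hD hc
        (nInverse_eq_C_mul_of_qDelta_eq hn hlam0 hlam hF hc h)) hT
    · exact h
  · intro h
    have hFn := coeff_ne_zero_of_norm_qDelta_lt hn hlam0 hlam hF hne h
    have ham := (coeff_qDelta_top_ne_zero (lam := lam) hn hlam0 hlam).2 hFn
    refine ⟨(mem_DBar_iff hn hlam0 hlam).2 ⟨?_, fun z hz =>
      norm_nInverse_lt_of_norm_lt ha hb ham h hz⟩, fun hT => ?_⟩
    · exact degree_eq_of_le_of_coeff_ne_zero (natDegree_le_iff_degree_le.1 hF) hFn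
    · have := h 2 (by simp)
      rw [norm_qDelta_nInverse_eq lam hT.1] at this
      exact lt_irrefl _ this

theorem norm_dualDelta_of_norm_eq_one {n : ℕ} (lam : ℝ) {F : ℂ[X]} (hF : F.natDegree ≤ n) {z : ℂ}
    (hz : ‖z‖ = 1) :
    ‖(dualDelta n lam F).eval z‖ = ‖(qDelta n lam (nInverse n F)).eval z‖ :=
  norm_eval_nInverse_of_norm_eq_one (natDegree_qDelta_le lam (natDegree_nInverse_le hF)) hz

theorem mem_DOpen_diff_TOpen_iff_norm_qDelta_lt {n : ℕ} (hn : 0 < n) {lam : ℝ} (hlam0 : 0 ≤ lam)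
    (hlam : lam < 2 * Real.pi / n) {F : ℂ[X]} (hF : F.natDegree ≤ n)
    (hne : F.coeff n ≠ 0 ∨ F.coeff 0 ≠ 0) :
    F ∈ DOpen n lam \ TOpen n lam ↔ ∀ z : ℂ, 1 ≤ ‖z‖ →
      ‖(qDelta n lam (nInverse n F)).eval z‖ < ‖(qDelta n lam F).eval z‖ := by
  have ha := natDegree_qDelta_le lam hF
  have hb := natDegree_qDelta_le lam (natDegree_nInverse_le hF)
  rw [mem_DOpen_diff_TOpen_iff hn hlam0 hlam]
  constructor
  · rintro ⟨-, hdeg, hD⟩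
    have ham := (coeff_qDelta_top_ne_zero (lam := lam) hn hlam0 hlam).2
      (coeff_ne_zero_of_eq_degree hdeg)
    have hcirc : ∀ z : ℂ, ‖z‖ = 1 →
        ‖(qDelta n lam (nInverse n F)).eval z‖ < ‖(qDelta n lam F).eval z‖ := by
      intro z hz
      have := hD z hz.ge
      rwa [norm_dualDelta_of_norm_eq_one lam hF hz, norm_mul, hz, one_mul] at this
    rcases eq_C_mul_or_norm_lt_of_norm_nInverse_lt ha hb ham fun z hz => hD z hz.le with
      ⟨c, hc, h⟩ | h
    · have := hcirc 1 (by simp)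
      rw [h, eval_mul, eval_C, norm_mul, hc, one_mul] at this
      exact absurd this (lt_irrefl _)
    · exact fun z hz => hz.lt_or_eq.elim (h z) fun h1 => hcirc z h1.symm
  · intro h
    have h' : ∀ z : ℂ, 1 < ‖z‖ →
        ‖(qDelta n lam (nInverse n F)).eval z‖ < ‖(qDelta n lam F).eval z‖ := fun z hz => h z hz.le
    have hFn := coeff_ne_zero_of_norm_qDelta_lt hn hlam0 hlam hF hne h'
    have ham := (coeff_qDelta_top_ne_zero (lam := lam) hn hlam0 hlam).2 hFn
    refine ⟨fun hT => ?_,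
      degree_eq_of_le_of_coeff_ne_zero (natDegree_le_iff_degree_le.1 hF) hFn, fun z hz => ?_⟩
    · have := h 1 (by simp)
      rw [norm_qDelta_nInverse_eq lam hT.1] at this
      exact lt_irrefl _ this
    · rcases hz.lt_or_eq with h1 | h1
      · exact norm_nInverse_lt_of_norm_lt ha hb ham h' h1
      · rw [norm_dualDelta_of_norm_eq_one lam hF h1.symm, norm_mul, ← h1, one_mul]
        exact h z hz

/-! ### The quotient of `Δ_λ^n[P]` and `Δ_λ^n[Q]` -/

theorem IsPhase.norm_eq_one {n : ℕ} {P : ℂ[X]} {c : ℂ} (h : IsPhase n P c) : ‖c‖ = 1 := by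
  obtain ⟨⟨t, -, -, rfl⟩, -⟩ := h
  exact Complex.norm_exp_ofReal_mul_I t

theorem IsPhase.nInverse_eq {n : ℕ} {P : ℂ[X]} {c : ℂ} (h : IsPhase n P c) :
    nInverse n P = C c * (C c * P) := by
  have hcc : c * starRingEnd ℂ c = 1 := by
    rw [Complex.mul_conj, Complex.normSq_eq_norm_sq, h.norm_eq_one]; simp
  have h1 : (C c * C (starRingEnd ℂ c) : ℂ[X]) = 1 := by rw [← C_mul, hcc, C_1]
  have h2 := h.2
  rw [nInverse_C_mul] at h2
  linear_combination C c * h2 - nInverse n P * h1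

/-- Distinct points of the half-open upper half-circle are linearly independent over `ℝ`. -/
theorem IsPhase.im_conj_mul_ne_zero {n : ℕ} {P Q : ℂ[X]} {cP cQ : ℂ} (hP : IsPhase n P cP)
    (hQ : IsPhase n Q cQ) (hne : cP ≠ cQ) : (starRingEnd ℂ cP * cQ).im ≠ 0 := by
  obtain ⟨⟨t, ht0, htπ, rfl⟩, -⟩ := hP
  obtain ⟨⟨s, hs0, hsπ, rfl⟩, -⟩ := hQ
  have h1 : starRingEnd ℂ (Complex.exp (t * Complex.I)) * Complex.exp (s * Complex.I) =
      Complex.exp ((s - t : ℝ) * Complex.I) := by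
    rw [← Complex.exp_conj, ← Complex.exp_add]
    congr 1
    simp
    ring
  rw [h1, Complex.exp_ofReal_mul_I_im]
  intro h
  have := (Real.sin_eq_zero_iff_of_lt_of_lt (by linarith) (by linarith)).1 h
  exact hne (by rw [sub_eq_zero.1 this])

theorem coeff_sub_ne_zero_or {n : ℕ} {P Q : ℂ[X]} (hPdeg : P.degree = n) {cP cQ : ℂ}
    (hP : IsPhase n P cP) (hQ : IsPhase n Q cQ) (hne : cP ≠ cQ) :
    (P - Q).coeff n ≠ 0 ∨ (P - Q).coeff 0 ≠ 0 := by
  by_contra! h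
  rw [coeff_sub, coeff_sub, sub_eq_zero, sub_eq_zero] at h
  have hPn : P.coeff n ≠ 0 := coeff_ne_zero_of_eq_degree hPdeg
  have h1 := congrArg (fun p : ℂ[X] => p.coeff n) hP.nInverse_eq
  have h2 := congrArg (fun p : ℂ[X] => p.coeff n) hQ.nInverse_eq
  simp only [coeff_nInverse, revAt_le le_rfl, Nat.sub_self, coeff_C_mul] at h1 h2
  rw [← h.1, ← h.2, h1] at h2
  have hsq : cP * cP = cQ * cQ := mul_right_cancel₀ hPn (by linear_combination h2)
  have him := hP.im_conj_mul_ne_zero hQ hne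
  rcases mul_self_eq_mul_self_iff.1 hsq with h3 | h3
  · exact hne h3
  · apply him
    rw [h3, map_neg, neg_mul, mul_comm, Complex.mul_conj, Complex.neg_im, Complex.ofReal_im,
      neg_zero]

/-- The real-bilinear identity behind the theorem. -/
theorem normSq_sub_normSq (a b x y : ℂ) :
    Complex.normSq (starRingEnd ℂ a * x - starRingEnd ℂ b * y) - Complex.normSq (a * x - b * y) =
      4 * (starRingEnd ℂ a * b).im * (x * starRingEnd ℂ y).im := by
  simp only [Complex.normSq_apply, Complex.sub_re, Complex.sub_im, Complex.mul_re,
    Complex.mul_im, Complex.conj_re, Complex.conj_im]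
  ring

theorem im_div_pos_iff (x y : ℂ) : 0 < (x / y).im ↔ 0 < (x * starRingEnd ℂ y).im := by
  rw [div_eq_mul_inv, Complex.inv_def, ← mul_assoc, Complex.im_mul_ofReal]
  by_cases hy : y = 0
  · simp [hy]
  · rw [mul_pos_iff_of_pos_right (inv_pos.2 (Complex.normSq_pos.2 hy))]

theorem im_div_neg_iff (x y : ℂ) : (x / y).im < 0 ↔ (x * starRingEnd ℂ y).im < 0 := by
  have := im_div_pos_iff (-x) y
  rwa [neg_div, neg_mul, Complex.neg_im, Complex.neg_im, neg_pos, neg_pos] at this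

theorem norm_qDelta_sub_sq {n : ℕ} (lam : ℝ) {P Q : ℂ[X]} {cP cQ : ℂ}
    (hP : IsPhase n P cP) (hQ : IsPhase n Q cQ) (z : ℂ) :
    ‖(qDelta n lam (P - Q)).eval z‖ ^ 2 - ‖(qDelta n lam (nInverse n (P - Q))).eval z‖ ^ 2 =
      4 * (starRingEnd ℂ cP * cQ).im * ((cP * (qDelta n lam P).eval z) *
        starRingEnd ℂ (cQ * (qDelta n lam Q).eval z)).im := by
  have hsub : nInverse n (P - Q) = nInverse n P - nInverse n Q := by
    simp [nInverse, reflect_sub]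
  have hcc : ∀ c : ℂ, ‖c‖ = 1 → starRingEnd ℂ c * c = 1 := fun c hc => by
    rw [mul_comm, Complex.mul_conj, Complex.normSq_eq_norm_sq, hc]; simp
  rw [← normSq_sub_normSq, ← Complex.normSq_eq_norm_sq, ← Complex.normSq_eq_norm_sq, hsub,
    hP.nInverse_eq, hQ.nInverse_eq]
  simp only [qDelta_sub, qDelta_C_mul, eval_sub, eval_mul, eval_C]
  rw [← mul_assoc (starRingEnd ℂ cP), ← mul_assoc (starRingEnd ℂ cQ), hcc _ hP.norm_eq_one,
    hcc _ hQ.norm_eq_one, one_mul, one_mul]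

theorem mapsIntoHalfPlane_deltaQuot_iff {n : ℕ} (lam : ℝ) {P Q : ℂ[X]} {cP cQ : ℂ}
    (hP : IsPhase n P cP) (hQ : IsPhase n Q cQ) (hne : cP ≠ cQ) (S : Set ℂ) :
    MapsIntoHalfPlane (deltaQuot n lam cP P cQ Q) S ↔
      (∀ z ∈ S, ‖(qDelta n lam (nInverse n (P - Q))).eval z‖ < ‖(qDelta n lam (P - Q)).eval z‖) ∨
      ∀ z ∈ S, ‖(qDelta n lam (P - Q)).eval z‖ < ‖(qDelta n lam (nInverse n (P - Q))).eval z‖ := by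
  have hlt : ∀ x y : ℂ, ‖x‖ < ‖y‖ ↔ 0 < ‖y‖ ^ 2 - ‖x‖ ^ 2 := fun x y => by
    rw [sub_pos, sq_lt_sq₀ (norm_nonneg _) (norm_nonneg _)]
  have hgt : ∀ x y : ℂ, ‖x‖ < ‖y‖ ↔ ‖x‖ ^ 2 - ‖y‖ ^ 2 < 0 := fun x y => by
    rw [sub_neg, sq_lt_sq₀ (norm_nonneg _) (norm_nonneg _)]
  have h1 : ∀ z, (0 < (deltaQuot n lam cP P cQ Q z).im ↔ _) := fun z => im_div_pos_iff _ _
  have h2 : ∀ z, ((deltaQuot n lam cP P cQ Q z).im < 0 ↔ _) := fun z => im_div_neg_iff _ _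
  simp only [MapsIntoHalfPlane, Set.MapsTo, Set.mem_ofPred_eq, h1, h2]
  rcases (hP.im_conj_mul_ne_zero hQ hne).lt_or_gt with hκ | hκ
  · have hκ' : 4 * (starRingEnd ℂ cP * cQ).im < 0 := by linarith
    rw [or_comm]
    refine or_congr (forall₂_congr fun z _ => ?_) (forall₂_congr fun z _ => ?_)
    · rw [hlt, norm_qDelta_sub_sq lam hP hQ]
      exact ⟨fun h => mul_pos_of_neg_of_neg hκ' h, fun h => by nlinarith⟩
    · rw [hgt, norm_qDelta_sub_sq lam hP hQ]
      exact ⟨fun h => mul_neg_of_neg_of_pos hκ' h, fun h => by nlinarith⟩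
  · have hκ' : 0 < 4 * (starRingEnd ℂ cP * cQ).im := by linarith
    refine or_congr (forall₂_congr fun z _ => ?_) (forall₂_congr fun z _ => ?_)
    · rw [hlt, norm_qDelta_sub_sq lam hP hQ, mul_pos_iff_of_pos_left hκ']
    · rw [hgt, norm_qDelta_sub_sq lam hP hQ]
      exact ⟨fun h => mul_neg_of_pos_of_neg hκ' h, fun h => by nlinarith⟩

theorem mainTheorem6 (n : ℕ) (hn : 0 < n) (lam : ℝ) (hlam0 : 0 ≤ lam)
    (hlam : lam < 2 * Real.pi / n) (P Q : ℂ[X])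
    (hP : P ∈ zerosIn n unitCircle) (hQ : Q ∈ zerosIn n unitCircle)
    (cP cQ : ℂ) (hcP : IsPhase n P cP) (hcQ : IsPhase n Q cQ) (hne : cP ≠ cQ) :
    (P - Q ∈ zerosIn n closedDisk →
      (P - Q ∈ DBar n lam \ TBar n lam ↔
        MapsIntoHalfPlane (deltaQuot n lam cP P cQ Q) {z | 1 < ‖z‖}) ∧
      (P - Q ∈ DOpen n lam \ TOpen n lam ↔
        MapsIntoHalfPlane (deltaQuot n lam cP P cQ Q) {z | 1 ≤ ‖z‖})) ∧
    ((P - Q ∈ DBar n lam \ TBar n lam ∨ nInverse n (P - Q) ∈ DBar n lam \ TBar n lam) ↔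
      MapsIntoHalfPlane (deltaQuot n lam cP P cQ Q) {z | 1 < ‖z‖}) ∧
    ((P - Q ∈ DOpen n lam \ TOpen n lam ∨ nInverse n (P - Q) ∈ DOpen n lam \ TOpen n lam) ↔
      MapsIntoHalfPlane (deltaQuot n lam cP P cQ Q) {z | 1 ≤ ‖z‖}) := by
  have hnd : (P - Q).natDegree ≤ n := natDegree_sub_le_of_le
    (natDegree_eq_of_degree_eq_some hP.1).le
    (natDegree_eq_of_degree_eq_some hQ.1).le |>.trans (max_self n).le
  have hcoeff := coeff_sub_ne_zero_or hP.1 hcP hcQ hne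
  rw [mapsIntoHalfPlane_deltaQuot_iff lam hcP hcQ hne,
    mapsIntoHalfPlane_deltaQuot_iff lam hcP hcQ hne]
  generalize P - Q = F at hnd hcoeff
  have hcoeff' : (nInverse n F).coeff n ≠ 0 ∨ (nInverse n F).coeff 0 ≠ 0 := by
    rw [coeff_nInverse, coeff_nInverse, revAt_le le_rfl, revAt_le (Nat.zero_le n), Nat.sub_self,
      Nat.sub_zero]
    simpa using hcoeff.symm
  have hnd' := natDegree_nInverse_le hnd
  have hbar := mem_DBar_diff_TBar_iff hn hlam0 hlam hnd hcoeff
  have hbar' := mem_DBar_diff_TBar_iff hn hlam0 hlam hnd' hcoeff'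
  have hopen := mem_DOpen_diff_TOpen_iff_norm_qDelta_lt hn hlam0 hlam hnd hcoeff
  have hopen' := mem_DOpen_diff_TOpen_iff_norm_qDelta_lt hn hlam0 hlam hnd' hcoeff'
  rw [nInverse_nInverse] at hbar' hopen'
  simp only [Set.mem_ofPred_eq]
  refine ⟨fun hF => ?_, or_congr hbar hbar', or_congr hopen hopen'⟩
  -- With all zeros of `F` in the closed disk, `F^{*n}` can lie in `DBar` only if the zeros are on
  -- the circle, and then the two moduli agree.
  have hexcl : ¬ ∀ z : ℂ, 1 < ‖z‖ →
      ‖(qDelta n lam F).eval z‖ < ‖(qDelta n lam (nInverse n F)).eval z‖ := by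
    intro h
    have hcd := DBar_subset_zerosIn_closedDisk n lam (hbar'.2 h).1
    have h1 := h 2 (by simp)
    rw [norm_qDelta_nInverse_eq lam (mem_zerosIn_unitCircle_of_closedDisk hF hcd)] at h1
    exact lt_irrefl _ h1
  have hexcl' : ¬ ∀ z : ℂ, 1 ≤ ‖z‖ →
      ‖(qDelta n lam F).eval z‖ < ‖(qDelta n lam (nInverse n F)).eval z‖ :=
    fun h => hexcl fun z hz => h z (le_of_lt hz)
  exact ⟨by rw [or_iff_left hexcl, hbar], by rw [or_iff_left hexcl', hopen]⟩
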